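/- Fix an integer $p\ge 3$. For $N\ge 1$, $\beta,h\in\mathbb R$, let $\mathbb P_{\beta,h,p}$ be the $p$-tensor Curie–Weiss model, i.e. the probability measure on $\{-1,1\}^N$ with $$\mathbb P_{\beta,h,p}(X)\ \propto\ \exp\Big\{\frac{\beta}{N^{p-1}}\sum_{1\le i_1,\dots,i_p\le N}X_{i_1}\cdots X_{i_p}+h\sum_{i=1}^N X_i\Big\}.$$ For known $h$ and a sample $X$, let $\hat\beta_N=\hat\beta_N(X)\in[-\infty,\infty]$ be a maximum likelihood estimate of $\beta\in\mathbb R$, i.e. a point of $[-\infty,\infty]$ at which the likelihood $\beta\mapsto\mathbb P_{\beta,h,p}(X)$, extended continuously to $[-\infty,\infty]$, attains its maximum. For $x\in[-1,1]$ put $$H_{\beta,h,p}(x)=\beta x^p+hx-\tfrac12\{(1+x)\log(1+x)+(1-x)\log(1-x)\},\qquad 0\log 0=0,$$ and let $\tilde\beta_p=\sup\{\beta\ge 0:\ \sup_{x\in[-1,1]}H_{\beta,0,p}(x)=0\}$. Let $\beta\ge 0$ and $h\in\mathbb R$ be such that $(\beta,h)$ is $p$-regular: $H=H_{\beta,h,p}$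 has a unique global maximizer $m_*$ on $[-1,1]$, $m_*\in(-1,1)$, and $H''(m_*)<0$. Suppose $X\sim\mathbb P_{\beta,h,p}$ and $h$ is known. Then, as $N\to\infty$, with convergence in distribution of $[-\infty,\infty]$-valued random variables: 1. If $m_*\ne 0$, then $\sqrt N(\hat\beta_N-\beta)\to N\Big(0,\,-\dfrac{H''(m_*)}{p^2m_*^{2p-2}}\Big)$. 2. $m_*=0$ if and only if $h=0$ and $\beta<\tilde\beta_p$. In this case $$\hat\beta_N\to\begin{cases}\tfrac12\delta_{\tilde\beta_p}+\tfrac12\delta_{-\tilde\beta_p}&\text{if }p\text{ is odd},\\ \gamma_p\,\delta_{-\infty}+(1-\gamma_p)\,\delta_{\tilde\beta_p}&\text{if }p\text{ is even},\end{cases}$$ where $\gamma_p=\mathbb P(Z^p\le\mathbb E Z^p)$ with $Z\sim N(0,1)$. -/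

import Mathlib

open MeasureTheory ProbabilityTheory Filter Topology

namespace CurieWeiss

/-- Spin configurations `X ∈ {-1, 1}^N`. -/
abbrev Config (N : ℕ) : Type := Fin N → ℤˣ

/-- The `i`-th spin as a real number. -/
def spin {N : ℕ} (X : Config N) (i : Fin N) : ℝ := ((X i : ℤ) : ℝ)

/-- The exponent
`(β / N^(p-1)) ∑_{i_1, ..., i_p} X_{i_1} ⋯ X_{i_p} + h ∑_i X_i`. -/
noncomputable def energy (p N : ℕ) (β h : ℝ) (X : Config N) : ℝ :=
  β / (N : ℝ) ^ (p - 1) * ∑ i : Fin p → Fin N, ∏ j, spin X (i j) + h * ∑ i, spin X i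

/-- The partition function `Z_N(β, h, p) = 2^{-N} ∑_X exp (energy X)`. -/
noncomputable def partitionFn (p N : ℕ) (β h : ℝ) : ℝ :=
  1 / 2 ^ N * ∑ X : Config N, Real.exp (energy p N β h X)

/-- The probability `P_{β,h,p}(X)`. As a function of `β` it is the likelihood of the sample `X`. -/
noncomputable def prob (p N : ℕ) (β h : ℝ) (X : Config N) : ℝ :=
  Real.exp (energy p N β h X) / (2 ^ N * partitionFn p N β h)

lemma two_pow_mul_partitionFn (p N : ℕ) (β h : ℝ) :
    2 ^ N * partitionFn p N β h = ∑ X : Config N, Real.exp (energy p N β h X) := by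
  unfold partitionFn
  field_simp

lemma sum_exp_pos (p N : ℕ) (β h : ℝ) :
    0 < ∑ X : Config N, Real.exp (energy p N β h X) :=
  Finset.sum_pos (fun _ _ => Real.exp_pos _) Finset.univ_nonempty

lemma prob_nonneg (p N : ℕ) (β h : ℝ) (X : Config N) : 0 ≤ prob p N β h X := by
  unfold prob
  rw [two_pow_mul_partitionFn]
  exact div_nonneg (Real.exp_pos _).le (sum_exp_pos p N β h).le

lemma sum_prob (p N : ℕ) (β h : ℝ) : ∑ X : Config N, prob p N β h X = 1 := by
  unfold prob
  rw [two_pow_mul_partitionFn, ← Finset.sum_div]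
  exact div_self (sum_exp_pos p N β h).ne'

/-- The `p`-tensor Curie-Weiss model as a probability mass function on `{-1, 1}^N`. -/
noncomputable def model (p N : ℕ) (β h : ℝ) : PMF (Config N) :=
  PMF.ofFintype (fun X => ENNReal.ofReal (prob p N β h X)) (by
    rw [← ENNReal.ofReal_sum_of_nonneg (fun X _ => prob_nonneg p N β h X), sum_prob,
      ENNReal.ofReal_one])

/-- `b ∈ [-∞, ∞]` is a maximum likelihood estimate of `β ∈ ℝ` from the sample `X`, with `h` known:
the likelihood has a limit at `b` (its value there, if `b` is finite), and this limit
is the maximum of the likelihood. -/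
def IsMLE (p N : ℕ) (h : ℝ) (X : Config N) (b : EReal) : Prop :=
  ∃ l : ℝ, Tendsto (fun t : ℝ => prob p N t h X) (comap Real.toEReal (𝓝 b)) (𝓝 l) ∧
    ∀ t : ℝ, prob p N t h X ≤ l

/-- The law, under the model with parameters `(β, h)`, of an extended-real statistic `T`. -/
noncomputable def law (p N : ℕ) (β h : ℝ) (T : Config N → EReal) : ProbabilityMeasure EReal :=
  ⟨((model p N β h).map T).toMeasure, inferInstance⟩

/-- Convergence in distribution on `[-∞, ∞]`, as `N → ∞`, of the statistics `T N` under the model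
with parameters `(β, h)`. -/
def ConvergesInLaw (p : ℕ) (β h : ℝ) (T : ∀ N, Config N → EReal)
    (ν : ProbabilityMeasure EReal) : Prop :=
  Tendsto (fun N => law p N β h (T N)) atTop (𝓝 ν)

/-- The binary entropy function `I`. -/
noncomputable def entropy (x : ℝ) : ℝ :=
  1 / 2 * ((1 + x) * Real.log (1 + x) + (1 - x) * Real.log (1 - x))

/-- The function `H_{β,h,p}(x) = β x^p + h x - I(x)`; only its values on `[-1, 1]` are used. -/
noncomputable def H (p : ℕ) (β h : ℝ) (x : ℝ) : ℝ := β * x ^ p + h * x - entropy x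

/-- `m ∈ (-1, 1)` is the unique global maximizer of `H_{β,h,p}` on `[-1, 1]`. -/
def IsUniqueMaximizer (p : ℕ) (β h m : ℝ) : Prop :=
  m ∈ Set.Ioo (-1 : ℝ) 1 ∧ ∀ x ∈ Set.Icc (-1 : ℝ) 1, x ≠ m → H p β h x < H p β h m

/-- `(β, h) ∈ [0, ∞) × ℝ` is `p`-regular. -/
def IsRegular (p : ℕ) (β h : ℝ) : Prop :=
  0 ≤ β ∧ ∃ m, IsUniqueMaximizer p β h m ∧ iteratedDeriv 2 (H p β h) m < 0

/-- The threshold `β̃_p = sup {β ≥ 0 : sup_{[-1,1]} H_{β,0,p} = 0}`. -/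
noncomputable def betaTilde (p : ℕ) : ℝ :=
  sSup {β : ℝ | 0 ≤ β ∧ sSup (H p β 0 '' Set.Icc (-1) 1) = 0}

/-- The normal distribution `N(0, v)` with `v ≥ 0`, seen as a probability measure on `[-∞, ∞]`. -/
noncomputable def normalLaw (v : ℝ) : ProbabilityMeasure EReal :=
  ⟨(gaussianReal 0 v.toNNReal).map Real.toEReal,
    Measure.isProbabilityMeasure_map measurable_coe_real_ereal.aemeasurable⟩

/-- The two-point distribution `w δ_a + (1 - w) δ_b` on `[-∞, ∞]`, for `w ∈ [0, 1]`. -/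
noncomputable def twoPoint (w : unitInterval) (a b : EReal) : ProbabilityMeasure EReal :=
  ⟨ENNReal.ofReal w • Measure.dirac a + ENNReal.ofReal (1 - w) • Measure.dirac b, ⟨by
    simp only [Measure.coe_add, Measure.coe_smul, Pi.add_apply, Pi.smul_apply, measure_univ,
      smul_eq_mul, mul_one]
    rw [← ENNReal.ofReal_add w.2.1 (sub_nonneg.2 w.2.2), add_sub_cancel, ENNReal.ofReal_one]⟩⟩

/-- The weight `1/2`. -/
noncomputable def oneHalf : unitInterval := ⟨1 / 2, by norm_num, by norm_num⟩

/-- `γ_p = P(Z^p ≤ E Z^p)` for a standard normal `Z`. -/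
noncomputable def gammaP (p : ℕ) : unitInterval :=
  ⟨(gaussianReal 0 1).real {z : ℝ | z ^ p ≤ ∫ y, y ^ p ∂(gaussianReal 0 1)},
    measureReal_nonneg, measureReal_le_one⟩

/-- The coefficient of `β` in the exponent. -/
noncomputable def coeff (p N : ℕ) (X : Config N) : ℝ :=
  1 / (N : ℝ) ^ (p - 1) * ∑ i : Fin p → Fin N, ∏ j, spin X (i j)

lemma inv_prob (p N : ℕ) (t h : ℝ) (X : Config N) :
    prob p N t h X = (∑ Y : Config N, Real.exp (t * (coeff p N Y - coeff p N X) +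
      h * (∑ i, spin Y i - ∑ i, spin X i)))⁻¹ := by
  unfold prob
  rw [two_pow_mul_partitionFn, ← inv_div, Finset.sum_div]
  congr 1
  refine Finset.sum_congr rfl fun Y _ => ?_
  rw [← Real.exp_sub]
  congr 1
  unfold energy coeff
  ring

lemma prob_le_one (p N : ℕ) (t h : ℝ) (X : Config N) : prob p N t h X ≤ 1 := by
  rw [← sum_prob p N t h]
  exact Finset.single_le_sum (fun Y _ => prob_nonneg p N t h Y) (Finset.mem_univ X)

lemma continuous_prob (p N : ℕ) (h : ℝ) (X : Config N) :
    Continuous fun t : ℝ => prob p N t h X := by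
  simp_rw [inv_prob]
  refine Continuous.inv₀ (by fun_prop) fun t => ?_
  exact (Finset.sum_pos (fun _ _ => Real.exp_pos _) Finset.univ_nonempty).ne'

lemma comap_nhds_coe (b : ℝ) : comap Real.toEReal (𝓝 (b : EReal)) = 𝓝 b :=
  (EReal.isOpenEmbedding_coe.isInducing.nhds_eq_comap b).symm

lemma comap_nhds_top : comap Real.toEReal (𝓝 ⊤) = atTop := by
  refine (EReal.nhds_top_basis.comap Real.toEReal).eq_of_same_basis ?_
  convert (atTop_basis_Ioi : (atTop : Filter ℝ).HasBasis _ _) using 2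
  ext x
  simp

lemma comap_nhds_bot : comap Real.toEReal (𝓝 ⊥) = atBot := by
  refine (EReal.nhds_bot_basis.comap Real.toEReal).eq_of_same_basis ?_
  convert (atBot_basis_Iio : (atBot : Filter ℝ).HasBasis _ _) using 2
  ext x
  simp

/-- A finite maximum likelihood estimate is a maximizer of the likelihood over `ℝ`. -/
lemma isMLE_coe_iff (p N : ℕ) (h : ℝ) (X : Config N) (b : ℝ) :
    IsMLE p N h X b ↔ ∀ t : ℝ, prob p N t h X ≤ prob p N b h X := by
  have hc : Tendsto (fun t : ℝ => prob p N t h X) (comap Real.toEReal (𝓝 (b : EReal)))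
      (𝓝 (prob p N b h X)) := by
    rw [comap_nhds_coe]
    exact (continuous_prob p N h X).tendsto b
  constructor
  · rintro ⟨l, hl, hmax⟩
    rw [comap_nhds_coe] at hc hl
    rwa [tendsto_nhds_unique hc hl]
  · exact fun hmax => ⟨_, hc, hmax⟩

/-- Every sample has a maximum likelihood estimate in `[-∞, ∞]`. -/
lemma exists_isMLE (p N : ℕ) (h : ℝ) (X : Config N) : ∃ b, IsMLE p N h X b := by
  have hbdd : BddAbove (Set.range fun t : ℝ => prob p N t h X) :=
    ⟨1, by rintro _ ⟨t, rfl⟩; exact prob_le_one p N t h X⟩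
  have hpos : ∀ t : ℝ, 0 < ∑ Y : Config N, Real.exp (t * (coeff p N Y - coeff p N X) +
      h * (∑ i, spin Y i - ∑ i, spin X i)) := fun t =>
    Finset.sum_pos (fun _ _ => Real.exp_pos _) Finset.univ_nonempty
  have hlim : ∀ (f : Filter ℝ) (Y : Config N),
      Tendsto (fun t : ℝ => t * (coeff p N Y - coeff p N X)) f atTop →
      Tendsto (fun t : ℝ => prob p N t h X) f (𝓝 0) := by
    intro f Y hY
    simp_rw [inv_prob]
    refine Tendsto.inv_tendsto_atTop (tendsto_atTop_mono (fun t => ?_)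
      (Real.tendsto_exp_atTop.comp
        (tendsto_atTop_add_const_right f (h * (∑ i, spin Y i - ∑ i, spin X i)) hY)))
    exact Finset.single_le_sum (f := fun Y : Config N =>
      Real.exp (t * (coeff p N Y - coeff p N X) + h * (∑ i, spin Y i - ∑ i, spin X i)))
      (fun _ _ => (Real.exp_pos _).le) (Finset.mem_univ Y)
  by_cases h1 : ∀ Y, coeff p N Y ≤ coeff p N X
  · refine ⟨⊤, ⨆ t, prob p N t h X, ?_, fun t => le_ciSup hbdd t⟩
    rw [comap_nhds_top]
    refine tendsto_atTop_ciSup (fun s t hst => ?_) hbdd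
    simp only [inv_prob]
    refine inv_anti₀ (hpos t) (Finset.sum_le_sum fun Y _ => ?_)
    exact Real.exp_le_exp.2 (add_le_add_left
      (mul_le_mul_of_nonpos_right hst (sub_nonpos.2 (h1 Y))) _)
  by_cases h2 : ∀ Y, coeff p N X ≤ coeff p N Y
  · refine ⟨⊥, ⨆ t, prob p N t h X, ?_, fun t => le_ciSup hbdd t⟩
    rw [comap_nhds_bot]
    refine tendsto_atBot_ciSup (fun s t hst => ?_) hbdd
    simp only [inv_prob]
    refine inv_anti₀ (hpos s) (Finset.sum_le_sum fun Y _ => ?_)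
    exact Real.exp_le_exp.2 (add_le_add_left
      (mul_le_mul_of_nonneg_right hst (sub_nonneg.2 (h2 Y))) _)
  push Not at h1 h2
  obtain ⟨Y1, hY1⟩ := h1
  obtain ⟨Y2, hY2⟩ := h2
  have hp0 : 0 < prob p N 0 h X := by
    rw [inv_prob]
    exact inv_pos.2 (hpos 0)
  have htop := hlim atTop Y1 (tendsto_id.atTop_mul_const (sub_pos.2 hY1))
  have hbot := hlim atBot Y2 (tendsto_id.atBot_mul_const_of_neg (sub_neg.2 hY2))
  obtain ⟨b, hb⟩ := (continuous_prob p N h X).exists_forall_ge' 0 (by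
    rw [cocompact_eq_atBot_atTop]
    exact eventually_sup.2 ⟨hbot.eventually_le_const hp0, htop.eventually_le_const hp0⟩)
  exact ⟨b, (isMLE_coe_iff p N h X b).2 hb⟩

end CurieWeiss

namespace CurieWeiss

/-! Write `X̄` for the magnetization and `u_N(t)` for the mean of `X̄^p` under the parameter `t`.
The likelihood is log-concave in the parameter, and its score at `t` is `N (X̄^p - u_N(t))`. Hence
the estimate is at most `t` if `X̄^p < u_N(t)` and at least `t` if `X̄^p > u_N(t)`, infinite
estimates included (`IsMLE.le_coe`, `IsMLE.coe_le`). The distribution function of the estimate at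
`t` is thus trapped between the probabilities, under the true `β`, of `X̄^p < u_N(t)` and `X̄^p ≤
u_N(t)`. What remains is the fluctuation of `X̄` under `β` and the size of `u_N(t)`.

Both come from Laplace's method. The law of `X̄` charges a grid point `x` with mass exactly
proportional to `peakWeight * exp (N H(x))`. Stirling's formula and dominated convergence show that
`√N (X̄ - m)` converges to a centred Gaussian `W` of variance `v = -1 / H''(m)`, along with
expectations of functions of exponential growth and with tilts of the parameter
(`tendsto_laplace_sum`, `IsNondegenerateMax.tendsto_expect_tilted`).

If `m ≠ 0`, put `κ = p m^(p-1)` and `t = β + s/√N`. The delta method sends `√N (X̄^p - m^p)` to `κ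
W`, and tilting `W` by `exp (s κ W)` sends `√N (u_N(t) - m^p)` to `s κ² v`. The limiting
distribution function is `P(κ W ≤ s κ² v)`, that of a centred normal of variance `1 / (κ² v)`.

If `m = 0`, then `H''(0) = -1` because `p ≥ 3`, and the scale is `√N^p`: `√N^p X̄^p` tends to `Z^p`.
The threshold `√N^p u_N(t)` tends to `E Z^p` as long as `0` is also the unique maximizer at `t`.
Beyond `β̃` it tends to `+∞`, and for odd `p` below `-β̃` to `-∞`, since Jensen's inequality bounds
`t u_N(t)` below by the free energy (`exists_eventually_le_mul_expect`). For odd `p` the middle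
range is `|t| < β̃` and `E Z^p = 0`; for even `p` it is all of `t < β̃`, so the mass `γ_p` escapes
to `-∞`. -/

/-- The binomial probability of `k` successes out of `N` when the success probability is `k / N`. -/
noncomputable def peakWeight (N k : ℕ) : ℝ :=
  N.choose k * ((k : ℝ) / N) ^ k * (((N - k : ℕ) : ℝ) / N) ^ (N - k)

/-- The magnetization of a configuration with `k` positive spins. -/
noncomputable def gridPoint (N k : ℕ) : ℝ := (2 * k - N) / N

/-- The magnetization of a configuration. -/
noncomputable def mag {N : ℕ} (X : Config N) : ℝ := (∑ i, spin X i) / N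

/-- The expectation of a function of the magnetization. -/
noncomputable def expect (p N : ℕ) (β h : ℝ) (F : ℝ → ℝ) : ℝ :=
  ∑ X : Config N, prob p N β h X * F (mag X)

/-! ### Binomial weights and Stirling's formula -/

lemma peakWeight_nonneg (N k : ℕ) : 0 ≤ peakWeight N k := by
  unfold peakWeight; positivity

/-- This is one term of the binomial expansion of `(k/N + (N-k)/N)^N = 1`. -/
lemma peakWeight_le_one {N k : ℕ} (hN : 0 < N) (hk : k ≤ N) : peakWeight N k ≤ 1 := by
  have hN' : (N : ℝ) ≠ 0 := by positivity
  have h1 : ((k : ℝ) / N) + (((N - k : ℕ) : ℝ) / N) = 1 := by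
    rw [Nat.cast_sub hk]; field_simp; ring
  have h2 := add_pow ((k : ℝ) / N) (((N - k : ℕ) : ℝ) / N) N
  rw [h1, one_pow] at h2
  rw [h2]
  refine le_trans (le_of_eq ?_) (Finset.single_le_sum
    (f := fun j => ((k : ℝ) / N) ^ j * (((N - k : ℕ) : ℝ) / N) ^ (N - j) * (N.choose j : ℝ))
    (fun j _ => by positivity) (Finset.mem_range.2 (Nat.lt_succ_of_le hk)))
  simp only [peakWeight]; ring

lemma factorial_eq_stirlingSeq {n : ℕ} (hn : 0 < n) :
    (n.factorial : ℝ) = Stirling.stirlingSeq n * (√(2 * n) * (n / Real.exp 1) ^ n) := by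
  unfold Stirling.stirlingSeq
  rw [div_mul_cancel₀]
  positivity

lemma stirlingSeq_pos {n : ℕ} (hn : 0 < n) : 0 < Stirling.stirlingSeq n := by
  obtain ⟨k, rfl⟩ := Nat.exists_eq_succ_of_ne_zero hn.ne'
  exact Stirling.stirlingSeq'_pos k

/-- The factors `(n / e)^n` in the three factorials cancel against the powers in `peakWeight`. Only
the Stirling ratios and the square roots survive, and both have limits. -/
lemma peakWeight_eq {N k : ℕ} (hk : 0 < k) (hkN : k < N) :
    √N * peakWeight N k = Stirling.stirlingSeq N /
      (Stirling.stirlingSeq k * Stirling.stirlingSeq (N - k)) /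
        √(2 * ((k : ℝ) / N) * (((N - k : ℕ) : ℝ) / N)) := by
  obtain ⟨j, rfl⟩ := Nat.exists_eq_add_of_lt hkN
  have e : k + j + 1 - k = j + 1 := by omega
  rw [peakWeight, Nat.choose_eq_factorial_div_factorial hkN.le, e,
    Nat.cast_div (by simpa [e] using Nat.factorial_mul_factorial_dvd_factorial hkN.le)
      (by positivity), Nat.cast_mul,
    factorial_eq_stirlingSeq (by omega : 0 < k + j + 1), factorial_eq_stirlingSeq hk,
    factorial_eq_stirlingSeq (by omega : 0 < j + 1)]
  have h1 := stirlingSeq_pos hk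
  have h2 := stirlingSeq_pos (by omega : 0 < j + 1)
  set n := k + j + 1 with hn
  set l := j + 1 with hl
  have hnl : n = k + l := by omega
  have hn0 : (0 : ℝ) < n := by positivity
  have hk0 : (0 : ℝ) < k := by positivity
  have hl0 : (0 : ℝ) < l := by positivity
  have hsq : √(2 * ((k : ℝ) / n) * ((l : ℝ) / n)) = √(2 * k) * √(2 * l) / (√2 * n) := by
    rw [Real.sqrt_eq_iff_mul_self_eq_of_pos (by positivity)]
    have := Real.mul_self_sqrt (show (0 : ℝ) ≤ 2 * k by positivity)
    have h3 := Real.mul_self_sqrt (show (0 : ℝ) ≤ 2 * l by positivity)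
    have h4 := Real.mul_self_sqrt (show (0 : ℝ) ≤ 2 by positivity)
    rw [div_mul_div_comm, mul_mul_mul_comm, this, h3, mul_mul_mul_comm √2, h4]
    field_simp
  rw [hsq]
  have hpow : ((n : ℝ) / Real.exp 1) ^ n =
      ((n : ℝ) / Real.exp 1) ^ k * ((n : ℝ) / Real.exp 1) ^ l := by
    rw [← pow_add, ← hnl]
  have hs2 : √(2 * (n : ℝ)) = √2 * √n := Real.sqrt_mul (by norm_num) _
  have hsn := Real.mul_self_sqrt hn0.le
  rw [hpow, hs2]
  simp only [div_pow]
  field_simp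
  rw [sq, hsn, mul_comm]

/-- Splits off the entropy exactly, with no error term: `exp (-N I)` is the reciprocal of `(2k/N)^k
(2(N-k)/N)^(N-k)`. The endpoints are covered because `0 log 0 = 0` and `0^0 = 1`. -/
lemma choose_eq {N k : ℕ} (hN : 0 < N) (hk : k ≤ N) :
    (N.choose k : ℝ) / 2 ^ N = peakWeight N k * Real.exp (-(N * entropy (gridPoint N k))) := by
  have hN' : (0 : ℝ) < N := by positivity
  have key : ∀ j : ℕ, Real.exp (-((j : ℝ) * Real.log (2 * (j / N)))) * (2 ^ j * ((j : ℝ) / N) ^ j)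
      = 1 := by
    intro j
    rcases Nat.eq_zero_or_pos j with rfl | hj
    · simp
    · have hj' : (0 : ℝ) < j := by positivity
      rw [← mul_pow, Real.exp_neg, mul_comm (j : ℝ), Real.exp_mul, Real.exp_log (by positivity),
        Real.rpow_natCast, inv_mul_cancel₀ (by positivity)]
  have hc : ((N - k : ℕ) : ℝ) = N - k := Nat.cast_sub hk
  have he : -(N * entropy (gridPoint N k)) = -((k : ℝ) * Real.log (2 * (k / N))) +
      -(((N - k : ℕ) : ℝ) * Real.log (2 * ((N - k : ℕ) / N))) := by
    unfold entropy gridPoint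
    have e1 : 1 + (2 * (k : ℝ) - N) / N = 2 * (k / N) := by field_simp; ring
    have e2 : 1 - (2 * (k : ℝ) - N) / N = 2 * ((N - k : ℕ) / N) := by rw [hc]; field_simp; ring
    rw [e1, e2]
    field_simp
    ring
  have h2 : (2 : ℝ) ^ N = 2 ^ k * 2 ^ (N - k) := by rw [← pow_add]; congr 1; omega
  have k1 := key k
  have k2 := key (N - k)
  rw [he, Real.exp_add, div_eq_iff (by positivity), h2, peakWeight]
  linear_combination (-(N.choose k : ℝ)) * k1 - (N.choose k : ℝ) *
    (Real.exp (-((k : ℝ) * Real.log (2 * (k / N)))) * (2 ^ k * ((k : ℝ) / N) ^ k)) * k2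

/-! ### Reduction to sums over the magnetization grid -/

lemma sum_config (N : ℕ) (F : ℝ → ℝ) :
    ∑ X : Config N, F (∑ i, spin X i) =
      ∑ k ∈ Finset.range (N + 1), (N.choose k : ℝ) * F (2 * k - N) := by
  classical
  let e : Finset (Fin N) → Config N := fun s i => if i ∈ s then 1 else -1
  have he : Function.Bijective e := by
    constructor
    · intro s t hst
      ext i
      have := congrFun hst i
      simp only [e] at this
      by_cases h1 : i ∈ s <;> by_cases h2 : i ∈ t <;> simp_all
    · intro X
      refine ⟨Finset.univ.filter fun i => X i = 1, ?_⟩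
      ext i
      rcases Int.units_eq_one_or (X i) with h | h <;> simp [e, h]
  have hs : ∀ s : Finset (Fin N), ∑ i, spin (e s) i = 2 * (s.card : ℝ) - N := by
    intro s
    have h1 : ∀ i, spin (e s) i = 2 * (if i ∈ s then (1 : ℝ) else 0) - 1 := by
      intro i
      by_cases h : i ∈ s <;> simp [spin, e, h]
      norm_num
    simp_rw [h1, Finset.sum_sub_distrib, ← Finset.mul_sum]
    simp
  rw [← he.sum_comp]
  simp_rw [hs]
  have := Finset.sum_powerset_apply_card (fun k : ℕ => F (2 * (k : ℝ) - N))
    (x := (Finset.univ : Finset (Fin N)))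
  simpa using this

lemma coeff_eq {p N : ℕ} (hp : 0 < p) (X : Config N) : coeff p N X = N * mag X ^ p := by
  unfold coeff mag
  rw [← Fintype.sum_pow]
  rcases Nat.eq_zero_or_pos N with rfl | hN
  · simp [hp.ne']
  obtain ⟨q, rfl⟩ := Nat.exists_eq_succ_of_ne_zero hp.ne'
  have hN' : (N : ℝ) ≠ 0 := by positivity
  simp only [Nat.succ_eq_add_one, Nat.add_sub_cancel, div_pow]
  field_simp
  ring

lemma energy_eq {p N : ℕ} (hp : 0 < p) (hN : 0 < N) (β h : ℝ) (X : Config N) :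
    energy p N β h X = N * (β * mag X ^ p + h * mag X) := by
  have hN' : (N : ℝ) ≠ 0 := by positivity
  have h1 : energy p N β h X = β * coeff p N X + h * ∑ i, spin X i := by
    unfold energy coeff; ring
  rw [h1, coeff_eq hp, mul_add, mag]
  field_simp

lemma sum_exp_energy_mul {p N : ℕ} (hp : 0 < p) (hN : 0 < N) (β h : ℝ) (F : ℝ → ℝ) :
    (∑ X : Config N, Real.exp (energy p N β h X) * F (mag X)) / 2 ^ N =
      ∑ k ∈ Finset.range (N + 1),
        peakWeight N k * Real.exp (N * H p β h (gridPoint N k)) * F (gridPoint N k) := by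
  simp_rw [energy_eq hp hN, mag]
  rw [sum_config N fun s => Real.exp (N * (β * (s / N) ^ p + h * (s / N))) * F (s / N),
    Finset.sum_div]
  refine Finset.sum_congr rfl fun k hk => ?_
  rw [mul_div_right_comm, choose_eq hN (Nat.lt_succ_iff.1 (Finset.mem_range.1 hk)), mul_assoc,
    ← mul_assoc (Real.exp _), ← Real.exp_add, mul_assoc]
  congr 3
  unfold H gridPoint
  ring

lemma expect_eq {p N : ℕ} (hp : 0 < p) (hN : 0 < N) (β h : ℝ) (F : ℝ → ℝ) :
    expect p N β h F =
      (∑ k ∈ Finset.range (N + 1),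
        peakWeight N k * Real.exp (N * H p β h (gridPoint N k)) * F (gridPoint N k)) /
      ∑ k ∈ Finset.range (N + 1),
        peakWeight N k * Real.exp (N * H p β h (gridPoint N k)) := by
  have h1 := sum_exp_energy_mul hp hN β h fun _ => 1
  simp only [mul_one] at h1
  rw [← h1, ← sum_exp_energy_mul hp hN, div_div_div_cancel_right₀ (by positivity), expect,
    Finset.sum_div]
  refine Finset.sum_congr rfl fun X _ => ?_
  rw [prob, two_pow_mul_partitionFn]
  ring

/-! ### Size of the binomial weights -/

/-- The limit of `√N` times the binomial weight at magnetization `m`. -/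
noncomputable def peakLimit (m : ℝ) : ℝ :=
  √Real.pi / (√Real.pi * √Real.pi) / √(2 * ((1 + m) / 2) * ((1 - m) / 2))

lemma peakLimit_pos {m : ℝ} (hm : m ∈ Set.Ioo (-1 : ℝ) 1) : 0 < peakLimit m := by
  have h1 : 0 < 1 + m := by linarith [hm.1]
  have h2 : 0 < 1 - m := by linarith [hm.2]
  unfold peakLimit
  positivity

lemma gridPoint_eq {N k : ℕ} (hN : 0 < N) : (k : ℝ) / N = (1 + gridPoint N k) / 2 := by
  have : (N : ℝ) ≠ 0 := by positivity
  unfold gridPoint; field_simp; ring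

lemma one_sub_gridPoint_eq {N k : ℕ} (hN : 0 < N) (hk : k ≤ N) :
    ((N - k : ℕ) : ℝ) / N = (1 - gridPoint N k) / 2 := by
  have : (N : ℝ) ≠ 0 := by positivity
  rw [Nat.cast_sub hk]
  unfold gridPoint; field_simp; ring

lemma gridPoint_mem {N k : ℕ} (hN : 0 < N) (hk : k ≤ N) :
    gridPoint N k ∈ Set.Icc (-1 : ℝ) 1 := by
  have h1 : (0 : ℝ) ≤ k / N := by positivity
  have h2 : (0 : ℝ) ≤ ((N - k : ℕ) : ℝ) / N := by positivity
  rw [gridPoint_eq hN] at h1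
  rw [one_sub_gridPoint_eq hN hk] at h2
  constructor <;> linarith

lemma interior_of_gridPoint {N k : ℕ} (hN : 0 < N) (h : gridPoint N k ∈ Set.Ioo (-1 : ℝ) 1) :
    0 < k ∧ k < N := by
  have hN' : (0 : ℝ) < N := by positivity
  obtain ⟨h1, h2⟩ := h
  unfold gridPoint at h1 h2
  rw [lt_div_iff₀ hN'] at h1
  rw [div_lt_iff₀ hN'] at h2
  constructor
  · exact_mod_cast (by linarith : (0 : ℝ) < k)
  · exact_mod_cast (by linarith : (k : ℝ) < N)

lemma tendsto_sqrt_mul_peakWeight {m : ℝ} (hm : m ∈ Set.Ioo (-1 : ℝ) 1) {k : ℕ → ℕ}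
    (hk : Tendsto (fun N => gridPoint N (k N)) atTop (𝓝 m)) :
    Tendsto (fun N : ℕ => √N * peakWeight N (k N)) atTop (𝓝 (peakLimit m)) := by
  have h1 : 0 < 1 + m := by linarith [hm.1]
  have h2 : 0 < 1 - m := by linarith [hm.2]
  have hev : ∀ᶠ N in atTop, 0 < N ∧ 0 < k N ∧ k N < N := by
    filter_upwards [hk.eventually (isOpen_Ioo.mem_nhds hm), eventually_gt_atTop 0] with N hN h0
    exact ⟨h0, interior_of_gridPoint h0 hN⟩
  have hNt : Tendsto (fun N : ℕ => (N : ℝ)) atTop atTop := tendsto_natCast_atTop_atTop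
  have hkt : Tendsto k atTop atTop := by
    rw [← tendsto_natCast_atTop_iff (R := ℝ)]
    refine (hNt.atTop_mul_pos (C := (1 + m) / 2) (by linarith)
      ((tendsto_const_nhds.add hk).div_const 2)).congr' ?_
    filter_upwards [hev] with N hN
    rw [← gridPoint_eq hN.1]
    have : (N : ℝ) ≠ 0 := by have := hN.1; positivity
    field_simp
  have hlt : Tendsto (fun N => N - k N) atTop atTop := by
    rw [← tendsto_natCast_atTop_iff (R := ℝ)]
    refine (hNt.atTop_mul_pos (C := (1 - m) / 2) (by linarith)
      ((tendsto_const_nhds.sub hk).div_const 2)).congr' ?_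
    filter_upwards [hev] with N hN
    rw [← one_sub_gridPoint_eq hN.1 hN.2.2.le]
    have : (N : ℝ) ≠ 0 := by have := hN.1; positivity
    field_simp
  have hs := Stirling.tendsto_stirlingSeq_sqrt_pi
  have hden : Tendsto (fun N => √(2 * ((1 + gridPoint N (k N)) / 2) *
      ((1 - gridPoint N (k N)) / 2))) atTop (𝓝 √(2 * ((1 + m) / 2) * ((1 - m) / 2))) :=
    (((tendsto_const_nhds.add hk).div_const 2).const_mul 2 |>.mul
      ((tendsto_const_nhds.sub hk).div_const 2)).sqrt
  refine ((hs.div ((hs.comp hkt).mul (hs.comp hlt)) (by positivity)).div hden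
    (by positivity)).congr' ?_
  filter_upwards [hev] with N hN
  rw [peakWeight_eq hN.2.1 hN.2.2, gridPoint_eq hN.1, one_sub_gridPoint_eq hN.1 hN.2.2.le]
  rfl

/-- `stirlingSeq` decreases to `√π`, so each factor of `peakWeight_eq` has a bound uniform in `N`
and `k`; the distance `δ` from `±1` controls the last square root. -/
lemma exists_sqrt_mul_peakWeight_le {δ : ℝ} (hδ : 0 < δ) : ∃ C : ℝ, 0 < C ∧ ∀ N k : ℕ, 0 < N →
    k ≤ N → |gridPoint N k| ≤ 1 - δ → √N * peakWeight N k ≤ C := by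
  refine ⟨Stirling.stirlingSeq 1 / (√Real.pi * √Real.pi) / √(2 * (δ / 2) * (δ / 2)), ?_, ?_⟩
  · have := stirlingSeq_pos one_pos
    positivity
  intro N k hN hk hx
  rw [abs_le] at hx
  obtain ⟨h1, h2⟩ := interior_of_gridPoint hN (k := k) ⟨by linarith, by linarith⟩
  rw [peakWeight_eq h1 h2, gridPoint_eq hN, one_sub_gridPoint_eq hN hk]
  have hle : Stirling.stirlingSeq N ≤ Stirling.stirlingSeq 1 := by
    obtain ⟨n, rfl⟩ := Nat.exists_eq_succ_of_ne_zero hN.ne'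
    exact Stirling.stirlingSeq'_antitone (Nat.zero_le n)
  have := stirlingSeq_pos hN
  have a1 := Stirling.sqrt_pi_le_stirlingSeq h1.ne'
  have a2 := Stirling.sqrt_pi_le_stirlingSeq (Nat.sub_pos_of_lt h2).ne'
  have := Real.pi_pos
  have := stirlingSeq_pos h1
  have := stirlingSeq_pos one_pos
  have : 0 ≤ 1 + gridPoint N k := by linarith
  gcongr <;> linarith

/-! ### Grid sums as integrals in the rescaled variable -/

/-- The index of the grid cell that contains the rescaled magnetization `w`. -/
noncomputable def cellIndex (m : ℝ) (N : ℕ) (w : ℝ) : ℕ := ⌊(N * (1 + m) + √N * w) / 2⌋₊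

/-- The rescaled magnetizations that belong to a grid cell. -/
def cells (m : ℝ) (N : ℕ) : Set ℝ := {w | (N * (1 + m) + √N * w) / 2 ∈ Set.Ico (0 : ℝ) (N + 1)}

lemma sum_eq_integral_floor (n : ℕ) (f : ℕ → ℝ) :
    ∑ k ∈ Finset.range n, f k =
      ∫ y, (Set.Ico (0 : ℝ) n).indicator (fun y => f ⌊y⌋₊) y := by
  induction n with
  | zero => simp
  | succ n ih =>
    have hind : ∀ y : ℝ, (Set.Ico (0 : ℝ) (n + 1 : ℕ)).indicator (fun y => f ⌊y⌋₊) y =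
        (Set.Ico (0 : ℝ) n).indicator (fun y => f ⌊y⌋₊) y +
          (Set.Ico (n : ℝ) (n + 1 : ℕ)).indicator (fun _ => f n) y := by
      intro y
      push_cast
      have hn : (0 : ℝ) ≤ n := n.cast_nonneg
      by_cases h1 : y < n
      · have h2 : y ∉ Set.Ico (n : ℝ) (n + 1) := fun h => absurd h.1 (not_le.2 h1)
        rw [Set.indicator_of_notMem h2, add_zero]
        by_cases h0 : 0 ≤ y
        · rw [Set.indicator_of_mem (by exact ⟨h0, by linarith⟩),
            Set.indicator_of_mem (by exact ⟨h0, h1⟩)]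
        · rw [Set.indicator_of_notMem fun h => h0 h.1, Set.indicator_of_notMem fun h => h0 h.1]
      · push Not at h1
        rw [Set.indicator_of_notMem (s := Set.Ico (0 : ℝ) n) (fun h => absurd h.2 (not_lt.2 h1)),
          zero_add]
        by_cases h3 : y < n + 1
        · rw [Set.indicator_of_mem (by exact ⟨by linarith, h3⟩),
            Set.indicator_of_mem (by exact ⟨h1, h3⟩),
            (Nat.floor_eq_iff (by linarith)).2 ⟨h1, h3⟩]
        · rw [Set.indicator_of_notMem fun h => h3 h.2, Set.indicator_of_notMem fun h => h3 h.2]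
    have hint : ∀ n : ℕ, Integrable ((Set.Ico (0 : ℝ) n).indicator fun y => f ⌊y⌋₊) := by
      intro n
      rw [integrable_indicator_iff measurableSet_Ico]
      have hmeas : Measurable fun y : ℝ => f ⌊y⌋₊ :=
        (measurable_of_countable f).comp Nat.measurable_floor
      refine Measure.integrableOn_of_bounded (M := ∑ k ∈ Finset.range n, |f k|) (by simp)
        hmeas.aestronglyMeasurable ?_
      filter_upwards [ae_restrict_mem measurableSet_Ico] with y hy
      exact Finset.single_le_sum (f := fun k => |f k|) (fun _ _ => abs_nonneg _)
        (Finset.mem_range.2 ((Nat.floor_lt hy.1).2 hy.2))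
    simp_rw [hind]
    rw [integral_add (hint n) (by
        rw [integrable_indicator_iff measurableSet_Ico]
        exact integrableOn_const (by simp)), Finset.sum_range_succ, ih,
      integral_indicator measurableSet_Ico]
    simp

/-- Substitution `y = (N (1 + m) + √N w) / 2` in the integral of the step function. The Jacobian `√N
/ 2` supplies the `√N` that normalizes `peakWeight`. -/
lemma sum_eq_integral_cells (m : ℝ) {N : ℕ} (hN : 0 < N) (f : ℕ → ℝ) :
    ∑ k ∈ Finset.range (N + 1), f k =
      ∫ w, (cells m N).indicator (fun w => √N / 2 * f (cellIndex m N w)) w := by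
  have hs : (0 : ℝ) < √N := by positivity
  rw [sum_eq_integral_floor]
  set g : ℝ → ℝ := fun y => (Set.Ico (0 : ℝ) (N + 1 : ℕ)).indicator (fun y => f ⌊y⌋₊) y with hg
  have h1 := Measure.integral_comp_mul_left (fun y => g (N * (1 + m) / 2 + y)) (√N / 2)
  rw [integral_add_left_eq_self g, abs_of_pos (by positivity), smul_eq_mul] at h1
  have h2 : ∫ y, g y = √N / 2 * ∫ w, g (N * (1 + m) / 2 + √N / 2 * w) := by
    rw [h1]; field_simp
  rw [h2, ← integral_const_mul]
  congr 1
  ext w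
  have e : (N : ℝ) * (1 + m) / 2 + √N / 2 * w = (N * (1 + m) + √N * w) / 2 := by ring
  simp only [hg, e]
  push_cast
  by_cases hw : (N * (1 + m) + √N * w) / 2 ∈ Set.Ico (0 : ℝ) (N + 1)
  · rw [Set.indicator_of_mem hw, Set.indicator_of_mem (show w ∈ cells m N from hw)]
    rfl
  · rw [Set.indicator_of_notMem hw, Set.indicator_of_notMem (show w ∉ cells m N from hw), mul_zero]

lemma measurableSet_cells (m : ℝ) (N : ℕ) : MeasurableSet (cells m N) :=
  measurableSet_Ico.preimage (f := fun w : ℝ => (N * (1 + m) + √N * w) / 2) (by fun_prop)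

lemma measurable_cellIndex (m : ℝ) (N : ℕ) : Measurable (cellIndex m N) :=
  Nat.measurable_floor.comp (by fun_prop)

lemma cellIndex_le {m : ℝ} {N : ℕ} {w : ℝ} (hw : w ∈ cells m N) : cellIndex m N w ≤ N := by
  have := (Nat.floor_lt hw.1).2 (by simpa using hw.2 : _ < ((N + 1 : ℕ) : ℝ))
  exact Nat.lt_succ_iff.1 this

lemma abs_cell_sub_le {m : ℝ} {N : ℕ} (hN : 0 < N) {w : ℝ} (hw : w ∈ cells m N) :
    |√N * (gridPoint N (cellIndex m N w) - m) - w| ≤ 2 / √N := by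
  have hs : (0 : ℝ) < √N := by positivity
  have hss : √(N : ℝ) * √N = N := Real.mul_self_sqrt (by positivity)
  have h1 := Nat.floor_le hw.1
  have h2 := Nat.lt_floor_add_one ((N * (1 + m) + √N * w) / 2)
  change ((cellIndex m N w : ℕ) : ℝ) ≤ _ at h1
  change _ < ((cellIndex m N w : ℕ) : ℝ) + 1 at h2
  have e : √N * (gridPoint N (cellIndex m N w) - m) - w =
      (2 * (cellIndex m N w : ℝ) - (N * (1 + m) + √N * w)) / √N := by
    unfold gridPoint
    rw [eq_div_iff hs.ne']
    have hN' : (N : ℝ) ≠ 0 := by positivity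
    calc (√N * ((2 * (cellIndex m N w : ℝ) - N) / N - m) - w) * √N
        = (√N * √N) * ((2 * (cellIndex m N w : ℝ) - N) / N - m) - w * √N := by ring
      _ = _ := by rw [hss]; field_simp; ring
  rw [e, abs_div, abs_of_pos hs]
  gcongr
  rw [abs_le]
  constructor <;> linarith

lemma eventually_mem_cells {m : ℝ} (hm : m ∈ Set.Ioo (-1 : ℝ) 1) (w : ℝ) :
    ∀ᶠ N in atTop, w ∈ cells m N := by
  have hs : Tendsto (fun N : ℕ => √(N : ℝ)) atTop atTop :=
    Real.tendsto_sqrt_atTop.comp tendsto_natCast_atTop_atTop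
  have h1 := (hs.const_mul_atTop (by linarith [hm.1] : 0 < 1 + m)).eventually_ge_atTop (-w)
  have h2 := (hs.const_mul_atTop (by linarith [hm.2] : 0 < 1 - m)).eventually_ge_atTop w
  filter_upwards [h1, h2] with N a b
  have hss : √(N : ℝ) * √N = N := Real.mul_self_sqrt (by positivity)
  have h0 := Real.sqrt_nonneg (N : ℝ)
  have a' := mul_le_mul_of_nonneg_left a h0
  have b' := mul_le_mul_of_nonneg_left b h0
  rw [mul_left_comm, hss] at a' b'
  constructor <;> linarith

lemma tendsto_cell {m : ℝ} (hm : m ∈ Set.Ioo (-1 : ℝ) 1) (w : ℝ) :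
    Tendsto (fun N : ℕ => √N * (gridPoint N (cellIndex m N w) - m)) atTop (𝓝 w) := by
  have hs : Tendsto (fun N : ℕ => √(N : ℝ)) atTop atTop :=
    Real.tendsto_sqrt_atTop.comp tendsto_natCast_atTop_atTop
  rw [tendsto_iff_norm_sub_tendsto_zero]
  refine squeeze_zero' (Eventually.of_forall fun _ => norm_nonneg _) ?_ (hs.const_div_atTop 2)
  filter_upwards [eventually_mem_cells hm w, eventually_gt_atTop 0] with N h1 h2
  exact abs_cell_sub_le h2 h1

lemma tendsto_of_tendsto_sqrt_mul {m w : ℝ} {x : ℕ → ℝ}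
    (h : Tendsto (fun N : ℕ => √N * (x N - m)) atTop (𝓝 w)) : Tendsto x atTop (𝓝 m) := by
  have hs : Tendsto (fun N : ℕ => √(N : ℝ)) atTop atTop :=
    Real.tendsto_sqrt_atTop.comp tendsto_natCast_atTop_atTop
  have := (h.div_atTop hs).add_const m
  rw [zero_add] at this
  refine this.congr' ?_
  filter_upwards [eventually_gt_atTop 0] with N hN
  have : √(N : ℝ) ≠ 0 := by positivity
  field_simp
  ring

/-! ### Laplace's method on the grid -/

/-- Near `±1` only `peakWeight ≤ 1` is available, but there `|x - m|` is bounded below, so `√N` is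
at most a constant times `√N |x - m|`. The exponential is harmless, as the Gaussian factor absorbs
it. -/
lemma exists_sqrt_mul_peakWeight_le_exp {m : ℝ} (hm : m ∈ Set.Ioo (-1 : ℝ) 1) :
    ∃ C : ℝ, 0 < C ∧ ∀ N k : ℕ, 0 < N → k ≤ N →
      √N * peakWeight N k ≤ C * Real.exp (√N * |gridPoint N k - m|) := by
  have hδ : 0 < (1 - |m|) / 2 := by linarith [abs_lt.2 hm]
  obtain ⟨C, hC, h⟩ := exists_sqrt_mul_peakWeight_le hδ
  refine ⟨C + 1 / ((1 - |m|) / 2), by positivity, fun N k hN hk => ?_⟩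
  have ha : 0 ≤ √N * |gridPoint N k - m| := by positivity
  set a := √N * |gridPoint N k - m| with hadef
  have he1 : 1 ≤ Real.exp a := Real.one_le_exp ha
  have he2 : a ≤ Real.exp a := by linarith [Real.add_one_le_exp a]
  rw [add_mul]
  by_cases hx : |gridPoint N k| ≤ 1 - (1 - |m|) / 2
  · have h1 := h N k hN hk hx
    have h2 : 0 ≤ 1 / ((1 - |m|) / 2) * Real.exp a := by positivity
    nlinarith
  · have h1 : (1 - |m|) / 2 ≤ |gridPoint N k - m| := by
      linarith [abs_sub_abs_le_abs_sub (gridPoint N k) m]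
    have h2 : √N ≤ 1 / ((1 - |m|) / 2) * a := by
      rw [hadef, div_mul_eq_mul_div, one_mul, le_div_iff₀ hδ]
      gcongr
    calc √N * peakWeight N k ≤ √N * 1 := by
          gcongr
          exact peakWeight_le_one hN hk
      _ ≤ 1 / ((1 - |m|) / 2) * Real.exp a := by
          rw [mul_one]
          exact h2.trans (by gcongr)
      _ ≤ _ := le_add_of_nonneg_left (by positivity)

/-- Integrable majorant for dominated convergence. Completing the square spends half of `c a²` on
the linear exponents, and `a² ≥ w²/2 - 4` turns the other half into `c w²/4 - 2c`. -/
lemma exp_quadratic_bound {c A a w : ℝ} (hc : 0 < c) (haw : |a - w| ≤ 2) :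
    Real.exp |a| * (Real.exp (-(c * a ^ 2)) * Real.exp (A * |a|)) ≤
      Real.exp ((A + 1) ^ 2 / (2 * c) + 2 * c) * Real.exp (-(c / 4) * w ^ 2) := by
  rw [← Real.exp_add, ← Real.exp_add, ← Real.exp_add]
  refine Real.exp_le_exp.2 ?_
  have h1 : (A + 1) * |a| ≤ c * a ^ 2 / 2 + (A + 1) ^ 2 / (2 * c) := by
    rw [← sub_nonneg]
    have : c * a ^ 2 / 2 + (A + 1) ^ 2 / (2 * c) - (A + 1) * |a| =
        (c * |a| - (A + 1)) ^ 2 / (2 * c) := by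
      rw [← sq_abs a]; field_simp; ring
    rw [this]; positivity
  have h2 : w ^ 2 ≤ 2 * a ^ 2 + 8 := by
    have h3 : (a - w) ^ 2 ≤ 4 := by
      rw [← sq_abs]; nlinarith [abs_nonneg (a - w)]
    nlinarith [sq_nonneg (2 * a - w)]
  nlinarith

/-- Laplace's method for sums over the magnetization grid. -/
lemma tendsto_laplace_sum {m c q A : ℝ} (hm : m ∈ Set.Ioo (-1 : ℝ) 1) (hc : 0 < c) {f : ℝ → ℝ}
    (hquad : ∀ x ∈ Set.Icc (-1 : ℝ) 1, f x - f m ≤ -(c * (x - m) ^ 2))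
    (hloc : ∀ (w : ℝ) (x : ℕ → ℝ), Tendsto (fun N : ℕ => √N * (x N - m)) atTop (𝓝 w) →
      Tendsto (fun N : ℕ => N * (f (x N) - f m)) atTop (𝓝 (q * w ^ 2 / 2)))
    {F : ℕ → ℝ → ℝ} {φ : ℝ → ℝ}
    (hF : ∀ N, ∀ x ∈ Set.Icc (-1 : ℝ) 1, |F N x| ≤ A * Real.exp (A * (√N * |x - m|)))
    (hlim : ∀ᵐ w : ℝ, ∀ x : ℕ → ℝ, Tendsto (fun N : ℕ => √N * (x N - m)) atTop (𝓝 w) →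
      Tendsto (fun N => F N (x N)) atTop (𝓝 (φ w))) :
    Tendsto (fun N : ℕ => ∑ k ∈ Finset.range (N + 1),
        peakWeight N k * Real.exp (N * (f (gridPoint N k) - f m)) * F N (gridPoint N k))
      atTop (𝓝 (∫ w, peakLimit m / 2 * (Real.exp (q * w ^ 2 / 2) * φ w))) := by
  obtain ⟨C, hC, hCb⟩ := exists_sqrt_mul_peakWeight_le_exp hm
  set G : ℕ → ℕ → ℝ := fun N k =>
    peakWeight N k * Real.exp (N * (f (gridPoint N k) - f m)) * F N (gridPoint N k) with hG
  have hA : 0 ≤ A := by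
    have := (abs_nonneg _).trans (hF 0 0 (by norm_num))
    exact nonneg_of_mul_nonneg_left this (Real.exp_pos _)
  have key : Tendsto (fun N : ℕ => ∫ w, (cells m N).indicator
      (fun w => √N / 2 * G N (cellIndex m N w)) w) atTop
      (𝓝 (∫ w, peakLimit m / 2 * (Real.exp (q * w ^ 2 / 2) * φ w))) := by
    refine tendsto_integral_filter_of_dominated_convergence
      (fun w => C / 2 * A * (Real.exp ((A + 1) ^ 2 / (2 * c) + 2 * c) *
        Real.exp (-(c / 4) * w ^ 2))) ?_ ?_ ?_ ?_
    · refine Eventually.of_forall fun N => ?_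
      exact ((((measurable_of_countable (G N)).comp (measurable_cellIndex m N)).const_mul
        (√N / 2)).indicator (measurableSet_cells m N)).aestronglyMeasurable
    · filter_upwards [eventually_gt_atTop 0] with N hN
      refine Eventually.of_forall fun w => ?_
      by_cases hw : w ∈ cells m N
      swap
      · rw [Set.indicator_of_notMem hw, norm_zero]
        positivity
      rw [Set.indicator_of_mem hw, Real.norm_eq_abs]
      have hk := cellIndex_le hw
      have hx := gridPoint_mem hN hk
      have hp := peakWeight_nonneg N (cellIndex m N w)
      have h1 := hCb N _ hN hk
      have h2 := hF N _ hx
      have h3 := hquad _ hx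
      have h4 := (abs_cell_sub_le hN hw).trans (b := 2 / √N) (c := 2) (by
        refine div_le_self (by norm_num) ?_
        rw [Real.one_le_sqrt]
        exact_mod_cast hN)
      set x := gridPoint N (cellIndex m N w) with hxdef
      have hab : √N * |x - m| = |√N * (x - m)| := by
        rw [abs_mul, abs_of_nonneg (Real.sqrt_nonneg _)]
      rw [hab] at h1 h2
      have h5 : Real.exp (N * (f x - f m)) ≤ Real.exp (-(c * (√N * (x - m)) ^ 2)) := by
        refine Real.exp_le_exp.2 ?_
        rw [mul_pow, Real.sq_sqrt (by positivity)]
        nlinarith [(N.cast_nonneg : (0 : ℝ) ≤ N)]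
      have h6 := exp_quadratic_bound (A := A) hc h4
      set a := √N * (x - m) with hadef
      calc |√N / 2 * G N (cellIndex m N w)|
          = 1 / 2 * ((√N * peakWeight N (cellIndex m N w)) *
              (Real.exp (N * (f x - f m)) * |F N x|)) := by
            simp only [hG, ← hxdef, abs_mul, abs_of_nonneg hp, abs_of_nonneg (Real.exp_pos _).le,
              abs_of_nonneg (show 0 ≤ √(N : ℝ) / 2 by positivity)]
            ring
        _ ≤ 1 / 2 * ((C * Real.exp |a|) * (Real.exp (-(c * a ^ 2)) *
              (A * Real.exp (A * |a|)))) := by gcongr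
        _ = C / 2 * A * (Real.exp |a| * (Real.exp (-(c * a ^ 2)) * Real.exp (A * |a|))) := by ring
        _ ≤ _ := by gcongr
    · exact ((integrable_exp_neg_mul_sq (by positivity : 0 < c / 4)).const_mul _).const_mul _
    -- The grid points along a fixed `w` form a sequence with `√N (x N - m) → w`. Phrasing the limit
    -- hypotheses along such sequences, for almost every `w`, admits discontinuous `F` that vary
    -- with `N`.
    · filter_upwards [hlim] with w hw
      have ht := tendsto_cell hm w
      have hprod := ((tendsto_sqrt_mul_peakWeight hm (tendsto_of_tendsto_sqrt_mul ht)).div_const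
        2).mul (((Real.continuous_exp.tendsto _).comp (hloc w _ ht)).mul (hw _ ht))
      refine hprod.congr' ?_
      filter_upwards [eventually_mem_cells hm w] with N hN
      rw [Set.indicator_of_mem hN]
      simp only [hG, Function.comp]
      ring
  refine key.congr' ?_
  filter_upwards [eventually_gt_atTop 0] with N hN
  rw [sum_eq_integral_cells m hN]

/-- The integral in Laplace's method is a Gaussian integral. -/
lemma integral_laplace_eq {q : ℝ} (hq : q < 0) (φ : ℝ → ℝ) (D : ℝ) :
    ∫ w, D * (Real.exp (q * w ^ 2 / 2) * φ w) =
      D * √(2 * Real.pi * (-1 / q)) * ∫ w, φ w ∂(gaussianReal 0 (-1 / q).toNNReal) := by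
  have hv : 0 < -1 / q := div_pos_of_neg_of_neg (by norm_num) hq
  have hv' : (-1 / q).toNNReal ≠ 0 := (Real.toNNReal_pos.2 hv).ne'
  have hpos : √(2 * Real.pi * (-1 / q)) ≠ 0 := by
    have := Real.pi_pos
    positivity
  rw [integral_gaussianReal_eq_integral_smul hv', integral_const_mul, mul_assoc,
    ← integral_const_mul √_]
  congr 2
  ext w
  simp only [gaussianPDFReal, smul_eq_mul, Real.coe_toNNReal _ hv.le, sub_zero]
  have : -w ^ 2 / (2 * (-1 / q)) = q * w ^ 2 / 2 := by
    have := hq.ne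
    field_simp
  rw [this, ← mul_assoc, ← mul_assoc, mul_inv_cancel₀ hpos, one_mul]

/-! ### Gaussian limits of expectations -/

/-- Local and global conditions on the exponent under which Laplace's method applies at `m`. -/
structure IsNondegenerateMax (p : ℕ) (β h m q : ℝ) : Prop where
  mem : m ∈ Set.Ioo (-1 : ℝ) 1
  neg : q < 0
  quad : ∃ c > 0, ∀ x ∈ Set.Icc (-1 : ℝ) 1, H p β h x - H p β h m ≤ -(c * (x - m) ^ 2)
  loc : ∀ (w : ℝ) (x : ℕ → ℝ), Tendsto (fun N : ℕ => √N * (x N - m)) atTop (𝓝 w) →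
    Tendsto (fun N : ℕ => N * (H p β h (x N) - H p β h m)) atTop (𝓝 (q * w ^ 2 / 2))

/-- The limiting variance of the rescaled magnetization. -/
noncomputable def limitVar (q : ℝ) : NNReal := (-1 / q).toNNReal

lemma IsNondegenerateMax.tendsto_sum {p : ℕ} {β h m q A : ℝ} (hH : IsNondegenerateMax p β h m q)
    {F : ℕ → ℝ → ℝ} {φ : ℝ → ℝ}
    (hF : ∀ N, ∀ x ∈ Set.Icc (-1 : ℝ) 1, |F N x| ≤ A * Real.exp (A * (√N * |x - m|)))
    (hlim : ∀ᵐ w : ℝ, ∀ x : ℕ → ℝ, Tendsto (fun N : ℕ => √N * (x N - m)) atTop (𝓝 w) →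
      Tendsto (fun N => F N (x N)) atTop (𝓝 (φ w))) :
    Tendsto (fun N : ℕ => ∑ k ∈ Finset.range (N + 1), peakWeight N k *
        Real.exp (N * (H p β h (gridPoint N k) - H p β h m)) * F N (gridPoint N k)) atTop
      (𝓝 (peakLimit m / 2 * √(2 * Real.pi * (-1 / q)) *
        ∫ w, φ w ∂(gaussianReal 0 (limitVar q)))) := by
  obtain ⟨c, hc, hquad⟩ := hH.quad
  rw [limitVar, ← integral_laplace_eq hH.neg]
  exact tendsto_laplace_sum hH.mem hc hquad hH.loc hF hlim

/-- Expectations of functions of the rescaled magnetization, under a perturbation of the field `β`,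
converge to ratios of Gaussian integrals. -/
lemma IsNondegenerateMax.tendsto_expect_tilted {p : ℕ} (hp : 0 < p) {β h m q A s : ℝ}
    (hH : IsNondegenerateMax p β h m q) {F : ℕ → ℝ → ℝ} {φ ψ : ℝ → ℝ} {b : ℕ → ℝ}
    (hψF : ∀ N, ∀ x ∈ Set.Icc (-1 : ℝ) 1,
      |Real.exp (N * (b N - β) * (x ^ p - s)) * F N x| ≤ A * Real.exp (A * (√N * |x - m|)))
    (hψ1 : ∀ N, ∀ x ∈ Set.Icc (-1 : ℝ) 1,
      |Real.exp (N * (b N - β) * (x ^ p - s))| ≤ A * Real.exp (A * (√N * |x - m|)))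
    (hψ : ∀ (w : ℝ) (x : ℕ → ℝ), Tendsto (fun N : ℕ => √N * (x N - m)) atTop (𝓝 w) →
      Tendsto (fun N => N * (b N - β) * (x N ^ p - s)) atTop (𝓝 (ψ w)))
    (hlim : ∀ᵐ w : ℝ, ∀ x : ℕ → ℝ, Tendsto (fun N : ℕ => √N * (x N - m)) atTop (𝓝 w) →
      Tendsto (fun N => F N (x N)) atTop (𝓝 (φ w)))
    (hne : ∫ w, Real.exp (ψ w) ∂(gaussianReal 0 (limitVar q)) ≠ 0) :
    Tendsto (fun N => expect p N (b N) h (F N)) atTop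
      (𝓝 ((∫ w, Real.exp (ψ w) * φ w ∂(gaussianReal 0 (limitVar q))) /
        ∫ w, Real.exp (ψ w) ∂(gaussianReal 0 (limitVar q)))) := by
  have hc : peakLimit m / 2 * √(2 * Real.pi * (-1 / q)) ≠ 0 := by
    have := peakLimit_pos hH.mem
    have := div_pos_of_neg_of_neg (by norm_num : (-1 : ℝ) < 0) hH.neg
    have := Real.pi_pos
    positivity
  have h1 := hH.tendsto_sum (φ := fun w => Real.exp (ψ w) * φ w) hψF (by
    filter_upwards [hlim] with w hw x hx
    exact ((Real.continuous_exp.tendsto _).comp (hψ w x hx)).mul (hw x hx))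
  have h2 := hH.tendsto_sum (φ := fun w => Real.exp (ψ w)) hψ1 (Eventually.of_forall
    fun w x hx => (Real.continuous_exp.tendsto _).comp (hψ w x hx))
  have h3 := h1.div h2 (mul_ne_zero hc hne)
  rw [mul_div_mul_left _ _ hc] at h3
  refine h3.congr' ?_
  filter_upwards [eventually_gt_atTop 0] with N hN
  rw [expect_eq hp hN]
  -- `H` is affine in the parameter, so changing it to `b N` multiplies the weights by an
  -- exponential. The centring `s` costs a factor independent of `x`, which cancels in the ratio.
  have hexp : ∀ x, Real.exp (N * H p (b N) h x) =
      Real.exp (N * H p β h m + N * (b N - β) * s) * (Real.exp (N * (H p β h x - H p β h m)) *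
        Real.exp (N * (b N - β) * (x ^ p - s))) := by
    intro x
    rw [← Real.exp_add, ← Real.exp_add]
    congr 1
    unfold H
    ring
  have hsum : ∀ g : ℕ → ℝ, ∑ k ∈ Finset.range (N + 1),
      peakWeight N k * Real.exp (N * H p (b N) h (gridPoint N k)) * g k =
      Real.exp (N * H p β h m + N * (b N - β) * s) * ∑ k ∈ Finset.range (N + 1),
        peakWeight N k * Real.exp (N * (H p β h (gridPoint N k) - H p β h m)) *
          (Real.exp (N * (b N - β) * (gridPoint N k ^ p - s)) * g k) := by
    intro g
    rw [Finset.mul_sum]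
    refine Finset.sum_congr rfl fun k _ => ?_
    rw [hexp]; ring
  have hsum1 := hsum fun _ => 1
  simp only [mul_one] at hsum1
  rw [hsum fun k => F N (gridPoint N k), hsum1, mul_div_mul_left _ _ (Real.exp_pos _).ne']
  rfl

lemma IsNondegenerateMax.tendsto_expect {p : ℕ} (hp : 0 < p) {β h m q A : ℝ}
    (hH : IsNondegenerateMax p β h m q) {F : ℕ → ℝ → ℝ} {φ : ℝ → ℝ}
    (hF : ∀ N, ∀ x ∈ Set.Icc (-1 : ℝ) 1, |F N x| ≤ A * Real.exp (A * (√N * |x - m|)))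
    (hlim : ∀ᵐ w : ℝ, ∀ x : ℕ → ℝ, Tendsto (fun N : ℕ => √N * (x N - m)) atTop (𝓝 w) →
      Tendsto (fun N => F N (x N)) atTop (𝓝 (φ w))) :
    Tendsto (fun N => expect p N β h (F N)) atTop
      (𝓝 (∫ w, φ w ∂(gaussianReal 0 (limitVar q)))) := by
  have hle : ∀ N : ℕ, ∀ x : ℝ, ∀ B C : ℝ, 0 ≤ B → B ≤ C →
      B * Real.exp (B * (√N * |x - m|)) ≤ C * Real.exp (C * (√N * |x - m|)) := by
    intro N x B C hB hBC
    have hC := hB.trans hBC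
    gcongr
  have hA : 0 ≤ A := by
    have := (abs_nonneg _).trans (hF 0 0 (by norm_num))
    exact nonneg_of_mul_nonneg_left this (Real.exp_pos _)
  -- The constant must also dominate the trivial tilt `1`, which `A` alone need not do; hence `A +
  -- 1`.
  have := hH.tendsto_expect_tilted hp (A := A + 1) (s := 0) (ψ := fun _ => 0) (b := fun _ => β)
    (F := F) (φ := φ) ?_ ?_ ?_ hlim (by simp)
  · simpa using this
  · intro N x hx
    simpa using (hF N x hx).trans (hle N x A (A + 1) hA (by linarith))
  · intro N x hx
    have h1 : 1 ≤ Real.exp ((A + 1) * (√N * |x - m|)) := Real.one_le_exp (by positivity)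
    simp only [sub_self, mul_zero, zero_mul, Real.exp_zero, abs_one]
    nlinarith
  · intro w x _
    simp

/-! ### Taylor expansion and the conditions for Laplace's method -/

lemma taylor_two_isLittleO {f : ℝ → ℝ} {s : Set ℝ} {m : ℝ} (hs : Convex ℝ s) (hso : IsOpen s)
    (hm : m ∈ s) (hf : ContDiffOn ℝ 2 f s) (hd : deriv f m = 0) :
    (fun x => f x - f m - iteratedDeriv 2 f m / 2 * (x - m) ^ 2) =o[𝓝 m]
      fun x => (x - m) ^ 2 := by
  have h := taylor_isLittleO (n := 2) hs hm (by exact_mod_cast hf)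
  rw [hso.nhdsWithin_eq hm] at h
  refine h.congr_left fun x => ?_
  rw [taylorWithinEval_succ, taylorWithinEval_succ, taylor_within_zero_eval,
    iteratedDerivWithin_of_isOpen hso hm, iteratedDerivWithin_of_isOpen hso hm]
  simp [iteratedDeriv_one, hd]
  ring

lemma tendsto_mul_sub_of_isLittleO {f : ℝ → ℝ} {m q : ℝ}
    (hf : (fun x => f x - f m - q / 2 * (x - m) ^ 2) =o[𝓝 m] fun x => (x - m) ^ 2)
    {w : ℝ} {x : ℕ → ℝ} (hx : Tendsto (fun N : ℕ => √N * (x N - m)) atTop (𝓝 w)) :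
    Tendsto (fun N : ℕ => N * (f (x N) - f m)) atTop (𝓝 (q * w ^ 2 / 2)) := by
  have hsq : Tendsto (fun N : ℕ => (N : ℝ) * (x N - m) ^ 2) atTop (𝓝 (w ^ 2)) := by
    refine (hx.pow 2).congr fun N => ?_
    rw [mul_pow, Real.sq_sqrt (by positivity)]
  have h1 := hf.comp_tendsto (tendsto_of_tendsto_sqrt_mul hx)
  have h2 := (Asymptotics.isBigO_refl (fun N : ℕ => (N : ℝ)) atTop).mul_isLittleO h1
  have h3 := (h2.trans_isBigO (hsq.isBigO_one ℝ)).tendsto_zero_of_tendsto tendsto_const_nhds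
  have h4 := h3.add (hsq.const_mul (q / 2))
  rw [zero_add, show q / 2 * w ^ 2 = q * w ^ 2 / 2 by ring] at h4
  refine h4.congr fun N => ?_
  simp only [Function.comp]
  ring

/-- Near `m` the Taylor remainder consumes half of the curvature term, leaving `c = -q/4`. Away from
`m`, compactness gives a gap `f m - f y`, and dividing it by `4` suffices because `(x - m)² ≤ 4`. -/
lemma exists_quadratic_bound {f : ℝ → ℝ} {m q : ℝ} (hq : q < 0)
    (hf : (fun x => f x - f m - q / 2 * (x - m) ^ 2) =o[𝓝 m] fun x => (x - m) ^ 2)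
    (hc : ContinuousOn f (Set.Icc (-1) 1)) (hm : m ∈ Set.Ioo (-1 : ℝ) 1)
    (hmax : ∀ x ∈ Set.Icc (-1 : ℝ) 1, x ≠ m → f x < f m) :
    ∃ c > 0, ∀ x ∈ Set.Icc (-1 : ℝ) 1, f x - f m ≤ -(c * (x - m) ^ 2) := by
  have h1 := hf.def (show 0 < -q / 4 by linarith)
  obtain ⟨δ, hδ, h2⟩ := Metric.eventually_nhds_iff.1 h1
  have hK : IsCompact (Set.Icc (-1 : ℝ) 1 ∩ {x | δ ≤ |x - m|}) :=
    isCompact_Icc.inter_right (isClosed_le continuous_const (by fun_prop))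
  have hnear : ∀ x, |x - m| < δ → f x - f m ≤ -(-q / 4 * (x - m) ^ 2) := by
    intro x hx
    have := h2 (y := x) (by simpa [Real.dist_eq] using hx)
    rw [Real.norm_eq_abs, Real.norm_eq_abs, abs_of_nonneg (sq_nonneg (x - m))] at this
    linarith [(abs_le.1 this).2]
  rcases (Set.Icc (-1 : ℝ) 1 ∩ {x | δ ≤ |x - m|}).eq_empty_or_nonempty with he | hne
  · refine ⟨-q / 4, by linarith, fun x hx => hnear x ?_⟩
    by_contra hcon
    exact Set.notMem_empty x (he ▸ ⟨hx, not_lt.1 hcon⟩)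
  · obtain ⟨y, hy, hymax⟩ := hK.exists_isMaxOn hne (hc.mono Set.inter_subset_left)
    have hym : y ≠ m := by
      rintro rfl
      have : δ ≤ |y - y| := hy.2
      simp at this
      linarith
    have hgap : 0 < f m - f y := sub_pos.2 (hmax y hy.1 hym)
    refine ⟨min (-q / 4) ((f m - f y) / 4), lt_min (by linarith) (by linarith), fun x hx => ?_⟩
    by_cases hxm : |x - m| < δ
    · have := hnear x hxm
      have := mul_le_mul_of_nonneg_right (min_le_left (-q / 4) ((f m - f y) / 4))
        (sq_nonneg (x - m))
      linarith
    · have h3 : f x ≤ f y := hymax ⟨hx, not_lt.1 hxm⟩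
      have h4 : (x - m) ^ 2 ≤ 4 := by nlinarith [hx.1, hx.2, hm.1, hm.2]
      have h5 := mul_le_mul_of_nonneg_right (min_le_right (-q / 4) ((f m - f y) / 4))
        (sq_nonneg (x - m))
      nlinarith

lemma continuous_entropy : Continuous entropy := by
  unfold entropy
  have h1 : Continuous fun x : ℝ => (1 + x) * Real.log (1 + x) :=
    Real.continuous_mul_log.comp (by fun_prop)
  have h2 : Continuous fun x : ℝ => (1 - x) * Real.log (1 - x) :=
    Real.continuous_mul_log.comp (by fun_prop)
  fun_prop

lemma continuous_H (p : ℕ) (β h : ℝ) : Continuous (H p β h) := by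
  unfold H
  have := continuous_entropy
  fun_prop

lemma contDiffOn_H (p : ℕ) (β h : ℝ) : ContDiffOn ℝ 2 (H p β h) (Set.Ioo (-1) 1) := by
  unfold H entropy
  intro x hx
  have h1 : 1 + x ≠ 0 := by linarith [hx.1]
  have h2 : 1 - x ≠ 0 := by linarith [hx.2]
  refine ContDiffAt.contDiffWithinAt ?_
  have e1 : ContDiffAt ℝ 2 (fun x : ℝ => 1 + x) x := by fun_prop
  have e2 : ContDiffAt ℝ 2 (fun x : ℝ => 1 - x) x := by fun_prop
  have e3 := e1.log h1
  have e4 := e2.log h2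
  fun_prop

lemma hasDerivAt_H (p : ℕ) (β h : ℝ) {x : ℝ} (hx : x ∈ Set.Ioo (-1 : ℝ) 1) :
    HasDerivAt (H p β h)
      (β * (p * x ^ (p - 1)) + h - 1 / 2 * (Real.log (1 + x) - Real.log (1 - x))) x := by
  have h1 : 1 + x ≠ 0 := by linarith [hx.1]
  have h2 : 1 - x ≠ 0 := by linarith [hx.2]
  have e1 : HasDerivAt (fun x : ℝ => 1 + x) 1 x := (hasDerivAt_id x).const_add 1
  have e2 : HasDerivAt (fun x : ℝ => 1 - x) (-1) x := (hasDerivAt_id x).const_sub 1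
  have e := (((hasDerivAt_pow p x).const_mul β).add ((hasDerivAt_id x).const_mul h)).sub
    (((e1.mul (e1.log h1)).add (e2.mul (e2.log h2))).const_mul (1 / 2))
  refine HasDerivAt.congr_deriv (f := H p β h) e ?_
  field_simp
  ring

/-- For `p ≥ 3` the term `β x^p` has no curvature at `0`. A maximizer at `0` is therefore always
nondegenerate, with limiting variance `1`. -/
lemma iteratedDeriv_two_H_zero {p : ℕ} (hp : 3 ≤ p) (β h : ℝ) :
    iteratedDeriv 2 (H p β h) 0 = -1 := by
  have h0 : (0 : ℝ) ∈ Set.Ioo (-1 : ℝ) 1 := by norm_num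
  have heq : deriv (H p β h) =ᶠ[𝓝 0] fun x => β * (p * x ^ (p - 1)) + h -
      1 / 2 * (Real.log (1 + x) - Real.log (1 - x)) := by
    filter_upwards [isOpen_Ioo.mem_nhds h0] with x hx using (hasDerivAt_H p β h hx).deriv
  rw [iteratedDeriv_succ, iteratedDeriv_one, heq.deriv_eq]
  have e1 : HasDerivAt (fun x : ℝ => 1 + x) 1 0 := (hasDerivAt_id 0).const_add 1
  have e2 : HasDerivAt (fun x : ℝ => 1 - x) (-1) 0 := (hasDerivAt_id 0).const_sub 1
  have e := (((((hasDerivAt_pow (p - 1) (0 : ℝ)).const_mul (p : ℝ)).const_mul β).add_const h)).sub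
    (((e1.log (by norm_num)).sub (e2.log (by norm_num))).const_mul (1 / 2))
  refine (e.deriv).trans ?_
  have : p - 1 - 1 ≠ 0 := by omega
  norm_num [this]

lemma IsUniqueMaximizer.deriv_eq_zero {p : ℕ} {β h m : ℝ} (hm : IsUniqueMaximizer p β h m) :
    deriv (H p β h) m = 0 := by
  refine IsLocalMax.deriv_eq_zero ?_
  filter_upwards [isOpen_Ioo.mem_nhds hm.1] with x hx
  rcases eq_or_ne x m with rfl | hne
  · exact le_rfl
  · exact (hm.2 x ⟨hx.1.le, hx.2.le⟩ hne).le

lemma IsUniqueMaximizer.isNondegenerateMax {p : ℕ} {β h m : ℝ} (hm : IsUniqueMaximizer p β h m)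
    (hq : iteratedDeriv 2 (H p β h) m < 0) :
    IsNondegenerateMax p β h m (iteratedDeriv 2 (H p β h) m) := by
  have ht := taylor_two_isLittleO (convex_Ioo (-1) 1) isOpen_Ioo hm.1 (contDiffOn_H p β h)
    hm.deriv_eq_zero
  exact ⟨hm.1, hq, exists_quadratic_bound hq ht (continuous_H p β h).continuousOn hm.1 hm.2,
    fun w x hx => tendsto_mul_sub_of_isLittleO ht hx⟩

lemma IsUniqueMaximizer.unique {p : ℕ} {β h m m' : ℝ} (hm : IsUniqueMaximizer p β h m)
    (hm' : IsUniqueMaximizer p β h m') : m = m' := by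
  by_contra hne
  have h1 := hm.2 m' ⟨hm'.1.1.le, hm'.1.2.le⟩ (Ne.symm hne)
  have h2 := hm'.2 m ⟨hm.1.1.le, hm.1.2.le⟩ hne
  linarith

/-! ### The entropy and the threshold -/

lemma sub_one_lt_mul_log {u : ℝ} (hu : 0 ≤ u) (hu1 : u ≠ 1) : u - 1 < u * Real.log u := by
  rcases hu.eq_or_lt with rfl | hpos
  · norm_num
  · have h1 := Real.log_lt_sub_one_of_pos (inv_pos.2 hpos) (by simpa using hu1)
    rw [Real.log_inv] at h1
    have h2 := mul_lt_mul_of_pos_left h1 hpos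
    rw [mul_sub, mul_inv_cancel₀ hpos.ne'] at h2
    linarith

lemma entropy_zero : entropy 0 = 0 := by simp [entropy]

lemma entropy_neg (x : ℝ) : entropy (-x) = entropy x := by
  unfold entropy
  rw [sub_neg_eq_add, ← sub_eq_add_neg]
  ring

lemma entropy_pos {x : ℝ} (hx : x ∈ Set.Icc (-1 : ℝ) 1) (h0 : x ≠ 0) : 0 < entropy x := by
  have h1 := sub_one_lt_mul_log (u := 1 + x) (by linarith [hx.1]) (by simpa using h0)
  have h2 := sub_one_lt_mul_log (u := 1 - x) (by linarith [hx.2]) (by simpa using h0)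
  unfold entropy
  linarith

lemma entropy_nonneg {x : ℝ} (hx : x ∈ Set.Icc (-1 : ℝ) 1) : 0 ≤ entropy x := by
  rcases eq_or_ne x 0 with rfl | h0
  · exact entropy_zero.ge
  · exact (entropy_pos hx h0).le

lemma sSup_H_eq_zero_iff {p : ℕ} (hp : p ≠ 0) (β : ℝ) :
    sSup (H p β 0 '' Set.Icc (-1) 1) = 0 ↔
      ∀ x ∈ Set.Icc (-1 : ℝ) 1, β * x ^ p ≤ entropy x := by
  have hbdd : BddAbove (H p β 0 '' Set.Icc (-1) 1) :=
    (isCompact_Icc.image (continuous_H p β 0)).bddAbove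
  have h0 : H p β 0 0 = 0 := by simp [H, entropy_zero, hp]
  have h0m : (0 : ℝ) ∈ H p β 0 '' Set.Icc (-1) 1 := ⟨0, by norm_num, h0⟩
  constructor
  · intro h x hx
    have := le_csSup hbdd ⟨x, hx, rfl⟩
    rw [h, H] at this
    linarith
  · intro h
    refine le_antisymm (csSup_le ⟨0, h0m⟩ ?_) (le_csSup hbdd h0m)
    rintro _ ⟨x, hx, rfl⟩
    have := h x hx
    rw [H]
    linarith

lemma bddAbove_threshold_set {p : ℕ} (hp : p ≠ 0) :
    BddAbove {β : ℝ | 0 ≤ β ∧ sSup (H p β 0 '' Set.Icc (-1) 1) = 0} := by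
  refine ⟨entropy 1, fun β hβ => ?_⟩
  simpa using (sSup_H_eq_zero_iff hp β).1 hβ.2 1 (by norm_num)

lemma zero_mem_threshold_set {p : ℕ} (hp : p ≠ 0) :
    (0 : ℝ) ∈ {β : ℝ | 0 ≤ β ∧ sSup (H p β 0 '' Set.Icc (-1) 1) = 0} := by
  refine ⟨le_rfl, (sSup_H_eq_zero_iff hp 0).2 fun x hx => ?_⟩
  simpa using entropy_nonneg hx

/-- Strictness comes from an admissible `b` with `t < b`: where `x^p > 0`, `t x^p < b x^p ≤ I(x)`;
elsewhere the left side is nonpositive. -/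
lemma mul_pow_lt_entropy {p : ℕ} (hp : p ≠ 0) {t : ℝ} (ht0 : 0 ≤ t) (ht : t < betaTilde p) {x : ℝ}
    (hx : x ∈ Set.Icc (-1 : ℝ) 1) (hx0 : x ≠ 0) : t * x ^ p < entropy x := by
  obtain ⟨b, hb, htb⟩ := exists_lt_of_lt_csSup ⟨0, zero_mem_threshold_set hp⟩ ht
  have h1 := (sSup_H_eq_zero_iff hp b).1 hb.2 x hx
  rcases le_or_gt (x ^ p) 0 with h | h
  · exact (mul_nonpos_of_nonneg_of_nonpos ht0 h).trans_lt (entropy_pos hx hx0)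
  · exact (mul_lt_mul_of_pos_right htb h).trans_le h1

lemma isUniqueMaximizer_zero_iff {p : ℕ} (hp : p ≠ 0) (t : ℝ) :
    IsUniqueMaximizer p t 0 0 ↔
      ∀ x ∈ Set.Icc (-1 : ℝ) 1, x ≠ 0 → t * x ^ p < entropy x := by
  have h0 : H p t 0 0 = 0 := by simp [H, entropy_zero, hp]
  constructor
  · intro h x hx hx0
    have := h.2 x hx hx0
    rw [h0, H] at this
    linarith
  · intro h
    refine ⟨by norm_num, fun x hx hx0 => ?_⟩
    rw [h0, H]
    linarith [h x hx hx0]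

lemma isUniqueMaximizer_zero {p : ℕ} (hp : p ≠ 0) {t : ℝ} (ht0 : 0 ≤ t) (ht : t < betaTilde p) :
    IsUniqueMaximizer p t 0 0 :=
  (isUniqueMaximizer_zero_iff hp t).2 fun _ hx hx0 => mul_pow_lt_entropy hp ht0 ht hx hx0

lemma isUniqueMaximizer_zero_of_even {p : ℕ} (hp : p ≠ 0) (he : Even p) {t : ℝ}
    (ht : t < betaTilde p) : IsUniqueMaximizer p t 0 0 := by
  rcases le_or_gt 0 t with h | h
  · exact isUniqueMaximizer_zero hp h ht
  · exact (isUniqueMaximizer_zero_iff hp t).2 fun x hx hx0 =>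
      (mul_nonpos_of_nonpos_of_nonneg h.le (he.pow_nonneg x)).trans_lt (entropy_pos hx hx0)

lemma isUniqueMaximizer_zero_of_odd {p : ℕ} (ho : Odd p) {t : ℝ}
    (ht : |t| < betaTilde p) : IsUniqueMaximizer p t 0 0 := by
  have hp : p ≠ 0 := ho.pos.ne'
  rcases le_or_gt 0 t with h | h
  · exact isUniqueMaximizer_zero hp h (by rwa [abs_of_nonneg h] at ht)
  · refine (isUniqueMaximizer_zero_iff hp t).2 fun x hx hx0 => ?_
    rw [abs_of_neg h] at ht
    have := mul_pow_lt_entropy hp (neg_pos.2 h).le ht (x := -x)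
      ⟨by linarith [hx.2], by linarith [hx.1]⟩ (neg_ne_zero.2 hx0)
    rwa [entropy_neg, ho.neg_pow, neg_mul_neg] at this

lemma isNondegenerateMax_zero {p : ℕ} (hp : 3 ≤ p) {t h : ℝ} (ht : IsUniqueMaximizer p t h 0) :
    IsNondegenerateMax p t h 0 (-1) := by
  rw [← iteratedDeriv_two_H_zero hp t h]
  exact ht.isNondegenerateMax (by rw [iteratedDeriv_two_H_zero hp]; norm_num)

lemma IsUniqueMaximizer.field_eq_zero {p : ℕ} (hp : 3 ≤ p) {β h : ℝ}
    (hm : IsUniqueMaximizer p β h 0) : h = 0 := by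
  have h1 := hm.deriv_eq_zero
  rw [(hasDerivAt_H p β h hm.1).deriv] at h1
  have : p - 1 ≠ 0 := by omega
  simpa [this] using h1

/-- The quadratic gap at `0` leaves room: `x^p ≤ x²` on `[-1, 1]`, so `β + c` still belongs to the
set whose supremum is `betaTilde p`. -/
lemma IsUniqueMaximizer.lt_betaTilde {p : ℕ} (hp : 3 ≤ p) {β : ℝ} (hβ : 0 ≤ β)
    (hm : IsUniqueMaximizer p β 0 0) : β < betaTilde p := by
  have hp0 : p ≠ 0 := by omega
  obtain ⟨c, hc, hquad⟩ := (isNondegenerateMax_zero hp hm).quad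
  have h0 : H p β 0 0 = 0 := by simp [H, entropy_zero, hp0]
  refine (lt_add_of_pos_right β hc).trans_le (le_csSup (bddAbove_threshold_set hp0)
    ⟨by positivity, (sSup_H_eq_zero_iff hp0 _).2 fun x hx => ?_⟩)
  have h1 := hquad x hx
  rw [h0, H] at h1
  have h2 : x ^ p ≤ x ^ 2 := by
    rw [← sq_abs x]
    exact (le_abs_self _).trans ((abs_pow x p).trans_le
      (pow_le_pow_of_le_one (abs_nonneg x) (abs_le.2 hx) (by omega)))
  nlinarith

lemma betaTilde_pos {p : ℕ} (hp : 3 ≤ p) : 0 < betaTilde p := by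
  refine IsUniqueMaximizer.lt_betaTilde hp le_rfl
    ((isUniqueMaximizer_zero_iff (by omega) 0).2 fun x hx hx0 => ?_)
  simpa using entropy_pos hx hx0

lemma exists_entropy_lt {p : ℕ} (hp : 3 ≤ p) {t : ℝ} (ht : betaTilde p < t) :
    ∃ x ∈ Set.Icc (-1 : ℝ) 1, entropy x < t * x ^ p := by
  by_contra! hcon
  have hp0 : p ≠ 0 := by omega
  exact absurd (le_csSup (bddAbove_threshold_set hp0)
    ⟨((betaTilde_pos hp).trans ht).le, (sSup_H_eq_zero_iff hp0 t).2 hcon⟩) (not_le.2 ht)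

/-! ### Log-concavity of the likelihood -/

lemma prob_pos (p N : ℕ) (β h : ℝ) (X : Config N) : 0 < prob p N β h X := by
  unfold prob
  rw [two_pow_mul_partitionFn]
  exact div_pos (Real.exp_pos _) (sum_exp_pos p N β h)

lemma energy_eq_add (p N : ℕ) (t b h : ℝ) (X : Config N) :
    energy p N b h X = energy p N t h X + (b - t) * coeff p N X := by
  unfold energy coeff; ring

lemma partitionFn_pos (p N : ℕ) (β h : ℝ) : 0 < partitionFn p N β h := by
  have := sum_exp_pos p N β h
  unfold partitionFn
  positivity

/-- Jensen's inequality for the partition function. -/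
lemma partitionFn_mul_exp_le {p N : ℕ} (hp : 0 < p) (t b h : ℝ) :
    partitionFn p N t h * Real.exp ((b - t) * (N * expect p N t h fun x => x ^ p)) ≤
      partitionFn p N b h := by
  have hZ := sum_exp_pos p N t h
  have hmean : N * expect p N t h (fun x => x ^ p) =
      ∑ X : Config N, prob p N t h X * coeff p N X := by
    rw [expect, Finset.mul_sum]
    refine Finset.sum_congr rfl fun X _ => ?_
    rw [coeff_eq hp]; ring
  have hratio : ∑ X : Config N, Real.exp (energy p N b h X) =
      (∑ X : Config N, Real.exp (energy p N t h X)) *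
        ∑ X : Config N, prob p N t h X * Real.exp ((b - t) * coeff p N X) := by
    rw [Finset.mul_sum]
    refine Finset.sum_congr rfl fun X _ => ?_
    rw [energy_eq_add p N t b, Real.exp_add, prob, two_pow_mul_partitionFn]
    field_simp
  have hjensen : Real.exp ((b - t) * (N * expect p N t h fun x => x ^ p)) ≤
      ∑ X : Config N, prob p N t h X * Real.exp ((b - t) * coeff p N X) := by
    have := convexOn_exp.map_sum_le (t := (Finset.univ : Finset (Config N)))
      (w := fun X => prob p N t h X) (p := fun X => (b - t) * coeff p N X)
      (fun X _ => prob_nonneg p N t h X) (sum_prob p N t h) (fun _ _ => Set.mem_univ _)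
    simp only [smul_eq_mul] at this
    refine le_trans (le_of_eq ?_) this
    rw [hmean, Finset.mul_sum]
    congr 1
    exact Finset.sum_congr rfl fun X _ => by ring
  unfold partitionFn
  rw [hratio, mul_assoc]
  gcongr

/-- Tangent-line bound for the concave log-likelihood: the factor multiplying `b - t` is the score
at `t`. No derivative in the parameter is needed. -/
lemma prob_le_prob_mul_exp {p N : ℕ} (hp : 0 < p) (t b h : ℝ) (X : Config N) :
    prob p N b h X ≤ prob p N t h X *
      Real.exp ((b - t) * (coeff p N X - N * expect p N t h fun x => x ^ p)) := by
  have h1 := partitionFn_mul_exp_le (N := N) hp t b h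
  have h2 := partitionFn_pos p N t h
  unfold prob
  rw [energy_eq_add p N t b, mul_sub, Real.exp_sub, Real.exp_add]
  calc _ ≤ Real.exp (energy p N t h X) * Real.exp ((b - t) * coeff p N X) /
        (2 ^ N * (partitionFn p N t h *
          Real.exp ((b - t) * (N * expect p N t h fun x => x ^ p)))) := by gcongr
    _ = _ := by field_simp

/-- A negative score at `t` makes the likelihood strictly smaller at every finite `b > t`, and the
tangent bound forces its limit at `+∞` to be `0`. -/
lemma IsMLE.le_coe {p N : ℕ} (hp : 0 < p) {h t : ℝ} {X : Config N} {b : EReal}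
    (hb : IsMLE p N h X b) (hX : coeff p N X < N * expect p N t h fun x => x ^ p) : b ≤ t := by
  by_contra! hlt
  have hneg := sub_neg.2 hX
  induction b with
  | bot => simp at hlt
  | coe b =>
    have hlt' : t < b := by exact_mod_cast hlt
    have h1 := (isMLE_coe_iff p N h X b).1 hb t
    have h2 := prob_le_prob_mul_exp hp t b h X
    have h3 := mul_lt_mul_of_pos_left (Real.exp_lt_one_iff.2 (mul_neg_of_pos_of_neg
      (sub_pos.2 hlt') hneg)) (prob_pos p N t h X)
    linarith
  | top =>
    obtain ⟨l, hl, hmax⟩ := hb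
    rw [comap_nhds_top] at hl
    have h1 : Tendsto (fun s : ℝ => prob p N t h X *
        Real.exp ((s - t) * (coeff p N X - N * expect p N t h fun x => x ^ p))) atTop
        (𝓝 (prob p N t h X * 0)) :=
      (Real.tendsto_exp_atBot.comp ((tendsto_atTop_add_const_right _ (-t)
        tendsto_id).atTop_mul_const_of_neg hneg)).const_mul _
    have h2 := le_of_tendsto_of_tendsto' hl h1 fun s => prob_le_prob_mul_exp hp t s h X
    linarith [hmax t, prob_pos p N t h X]

lemma IsMLE.coe_le {p N : ℕ} (hp : 0 < p) {h t : ℝ} {X : Config N} {b : EReal}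
    (hb : IsMLE p N h X b) (hX : (N * expect p N t h fun x => x ^ p) < coeff p N X) : t ≤ b := by
  by_contra! hlt
  have hpos := sub_pos.2 hX
  induction b with
  | top => simp at hlt
  | coe b =>
    have hlt' : b < t := by exact_mod_cast hlt
    have h1 := (isMLE_coe_iff p N h X b).1 hb t
    have h2 := prob_le_prob_mul_exp hp t b h X
    have h3 := mul_lt_mul_of_pos_left (Real.exp_lt_one_iff.2 (mul_neg_of_neg_of_pos
      (sub_neg.2 hlt') hpos)) (prob_pos p N t h X)
    linarith
  | bot =>
    obtain ⟨l, hl, hmax⟩ := hb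
    rw [comap_nhds_bot] at hl
    have h1 : Tendsto (fun s : ℝ => prob p N t h X *
        Real.exp ((s - t) * (coeff p N X - N * expect p N t h fun x => x ^ p))) atBot
        (𝓝 (prob p N t h X * 0)) :=
      (Real.tendsto_exp_atBot.comp ((tendsto_atBot_add_const_right _ (-t)
        tendsto_id).atBot_mul_const hpos)).const_mul _
    have h2 := le_of_tendsto_of_tendsto' hl h1 fun s => prob_le_prob_mul_exp hp t s h X
    linarith [hmax t, prob_pos p N t h X]

/-! ### Distribution functions of the estimate -/

lemma law_real_apply (p N : ℕ) (β h : ℝ) (T : Config N → EReal) {s : Set EReal}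
    (hs : MeasurableSet s) :
    (law p N β h T : Measure EReal).real s =
      ∑ X : Config N, prob p N β h X * (T ⁻¹' s).indicator (fun _ => (1 : ℝ)) X := by
  classical
  let _ : MeasurableSpace (Config N) := ⊤
  have h1 : (law p N β h T : Measure EReal) s =
      ∑ X : Config N, (T ⁻¹' s).indicator (model p N β h) X := by
    change ((model p N β h).map T).toMeasure s = _
    rw [PMF.toMeasure_map_apply T _ s (measurable_from_top) hs,
      PMF.toMeasure_apply_fintype]
  rw [measureReal_def, h1, ENNReal.toReal_sum]
  · refine Finset.sum_congr rfl fun X _ => ?_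
    by_cases hX : X ∈ T ⁻¹' s
    · rw [Set.indicator_of_mem hX, Set.indicator_of_mem hX, mul_one]
      change (ENNReal.ofReal _).toReal = _
      exact ENNReal.toReal_ofReal (prob_nonneg p N β h X)
    · simp [Set.indicator_of_notMem hX]
  · intro X _
    by_cases hX : X ∈ T ⁻¹' s
    · rw [Set.indicator_of_mem hX]
      exact ENNReal.ofReal_ne_top
    · simp [Set.indicator_of_notMem hX]

/-- Lower half of the sandwich. The second statistic `T'` allows the rescaled estimate, whose events
translate into events for `T`. -/
lemma expect_lt_le_law_real {p N : ℕ} (hp : 0 < p) (hN : 0 < N) {β h t : ℝ}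
    {T : Config N → EReal} (hT : ∀ X, IsMLE p N h X (T X)) {s : Set EReal}
    (hs : MeasurableSet s) {T' : Config N → EReal} (hTs : ∀ X, T X ≤ t → T' X ∈ s) :
    expect p N β h ({x | x ^ p < expect p N t h fun x => x ^ p}.indicator fun _ => 1) ≤
      (law p N β h T' : Measure EReal).real s := by
  rw [law_real_apply _ _ _ _ _ hs, expect]
  refine Finset.sum_le_sum fun X _ => mul_le_mul_of_nonneg_left ?_ (prob_nonneg p N β h X)
  by_cases hX : mag X ^ p < expect p N t h fun x => x ^ p
  · have : X ∈ T' ⁻¹' s := hTs X ((hT X).le_coe hp (by rw [coeff_eq hp]; gcongr))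
    rw [Set.indicator_of_mem this]
    exact Set.indicator_le_self' (fun _ _ => zero_le_one) _
  · rw [Set.indicator_of_notMem (by exact hX)]
    exact Set.indicator_nonneg (fun _ _ => zero_le_one) _

/-- Upper half of the sandwich. A zero score does not decide on which side of `t` the estimate lies,
hence the weak inequality here and the strict bound `T X < t`. -/
lemma law_real_le_expect_le {p N : ℕ} (hp : 0 < p) (hN : 0 < N) {β h t : ℝ}
    {T : Config N → EReal} (hT : ∀ X, IsMLE p N h X (T X)) {s : Set EReal}
    (hs : MeasurableSet s) {T' : Config N → EReal} (hTs : ∀ X, T' X ∈ s → T X < t) :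
    (law p N β h T' : Measure EReal).real s ≤
      expect p N β h ({x | x ^ p ≤ expect p N t h fun x => x ^ p}.indicator fun _ => 1) := by
  rw [law_real_apply _ _ _ _ _ hs, expect]
  refine Finset.sum_le_sum fun X _ => mul_le_mul_of_nonneg_left ?_ (prob_nonneg p N β h X)
  by_cases hX : mag X ^ p ≤ expect p N t h fun x => x ^ p
  · rw [Set.indicator_of_mem (s := {x | x ^ p ≤ _}) hX]
    exact Set.indicator_le_self' (fun _ _ => zero_le_one) _
  · have : X ∉ T' ⁻¹' s := fun hcon => absurd ((hT X).coe_le hp (by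
      rw [coeff_eq hp]
      push Not at hX
      gcongr)) (not_le.2 (hTs X hcon))
    rw [Set.indicator_of_notMem this]
    exact Set.indicator_nonneg (fun _ _ => zero_le_one) _

/-! ### Convergence in law on the extended reals -/

/-- Convergence of distribution functions at a dense set of reals implies convergence in law
on the extended reals. -/
lemma tendsto_probabilityMeasure_ereal {D : Set ℝ} (hD : Dense D)
    {μ : ℕ → ProbabilityMeasure EReal} {ν : ProbabilityMeasure EReal}
    (h : ∀ t ∈ D, Tendsto (fun N => (μ N : Measure EReal).real (Set.Iic (t : EReal))) atTop
      (𝓝 ((ν : Measure EReal).real (Set.Iic (t : EReal))))) :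
    Tendsto μ atTop (𝓝 ν) := by
  -- These sets form a chain, so their differences are closed under intersection, and the measure of
  -- a difference is either zero or a difference of measures.
  set E : Set (Set EReal) := {s | s = ∅ ∨ s = Set.univ ∨ ∃ t ∈ D, s = Set.Iic (t : EReal)} with hE
  have hchain : ∀ s ∈ E, ∀ s' ∈ E, s ⊆ s' ∨ s' ⊆ s := by
    rintro s (rfl | rfl | ⟨t, -, rfl⟩) s' (rfl | rfl | ⟨t', -, rfl⟩) <;>
      simp [Set.Iic_subset_Iic, le_total]
  have hinter : ∀ s ∈ E, ∀ s' ∈ E, s ∩ s' ∈ E := fun s hs s' hs' => by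
    rcases hchain s hs s' hs' with h | h
    · rwa [Set.inter_eq_left.2 h]
    · rwa [Set.inter_eq_right.2 h]
  have hunion : ∀ s ∈ E, ∀ s' ∈ E, s ∪ s' ∈ E := fun s hs s' hs' => by
    rcases hchain s hs s' hs' with h | h
    · rwa [Set.union_eq_right.2 h]
    · rwa [Set.union_eq_left.2 h]
  have hmeas : ∀ s ∈ E, MeasurableSet s := by
    rintro s (rfl | rfl | ⟨t, -, rfl⟩)
    exacts [MeasurableSet.empty, MeasurableSet.univ, measurableSet_Iic]
  have htend : ∀ s ∈ E, Tendsto (fun N => (μ N : Measure EReal).real s) atTop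
      (𝓝 ((ν : Measure EReal).real s)) := by
    rintro s (rfl | rfl | ⟨t, ht, rfl⟩)
    · simp
    · simp
    · exact h t ht
  -- The differences include `(a, b]`, `[-∞, b]` and `(a, ∞]`, which provide small neighbourhoods of
  -- every point, `±∞` included.
  refine IsPiSystem.tendsto_probabilityMeasure_of_tendsto_of_mem
    (S := {s | ∃ A ∈ E, ∃ B ∈ E, s = A \ B}) ?_ ?_ ?_ ?_
  · rintro _ ⟨A, hA, B, hB, rfl⟩ _ ⟨A', hA', B', hB', rfl⟩ -
    refine ⟨A ∩ A', hinter A hA A' hA', B ∪ B', hunion B hB B' hB', ?_⟩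
    ext x
    simp only [Set.mem_inter_iff, Set.mem_sdiff, Set.mem_union]
    tauto
  · rintro _ ⟨A, hA, B, hB, rfl⟩
    exact (hmeas A hA).diff (hmeas B hB)
  · intro u hu x hx
    have hnhds := hu.mem_nhds hx
    induction x with
    | bot =>
      obtain ⟨y, -, hy⟩ := EReal.nhds_bot_basis.mem_iff.1 hnhds
      obtain ⟨b, hb, hby⟩ := hD.exists_lt y
      refine ⟨_, ⟨Set.Iic (b : EReal), .inr (.inr ⟨b, hb, rfl⟩), ∅, .inl rfl, rfl⟩, ?_, ?_⟩
      · rw [Set.sdiff_empty]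
        exact Iic_mem_nhds (EReal.bot_lt_coe b)
      · rw [Set.sdiff_empty]
        exact fun z hz => hy (lt_of_le_of_lt (Set.mem_Iic.1 hz) (EReal.coe_lt_coe_iff.2 hby))
    | top =>
      obtain ⟨y, -, hy⟩ := EReal.nhds_top_basis.mem_iff.1 hnhds
      obtain ⟨a, ha, hya⟩ := hD.exists_gt y
      refine ⟨_, ⟨Set.univ, .inr (.inl rfl), Set.Iic (a : EReal), .inr (.inr ⟨a, ha, rfl⟩), rfl⟩,
        ?_, ?_⟩
      · rw [← Set.compl_eq_univ_sdiff, Set.compl_Iic]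
        exact Ioi_mem_nhds (EReal.coe_lt_top a)
      · rw [← Set.compl_eq_univ_sdiff, Set.compl_Iic]
        exact fun z hz => hy (lt_trans (EReal.coe_lt_coe_iff.2 hya) (Set.mem_Ioi.1 hz))
    | coe x =>
      have h1 : Real.toEReal ⁻¹' u ∈ 𝓝 x :=
        continuous_coe_real_ereal.continuousAt.preimage_mem_nhds hnhds
      obtain ⟨ε, hε, hball⟩ := Metric.mem_nhds_iff.1 h1
      obtain ⟨a, ha, ha1, ha2⟩ := hD.exists_between (show x - ε < x by linarith)
      obtain ⟨b, hb, hb1, hb2⟩ := hD.exists_between (show x < x + ε by linarith)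
      refine ⟨_, ⟨Set.Iic (b : EReal), .inr (.inr ⟨b, hb, rfl⟩), Set.Iic (a : EReal),
        .inr (.inr ⟨a, ha, rfl⟩), rfl⟩, ?_, ?_⟩
      · rw [Set.sdiff_eq, Set.compl_Iic]
        exact inter_mem (Iic_mem_nhds (by exact_mod_cast hb1))
          (Ioi_mem_nhds (by exact_mod_cast ha2))
      · rintro z ⟨hz1, hz2⟩
        rw [Set.mem_Iic] at hz1
        rw [Set.mem_Iic, not_le] at hz2
        induction z with
        | bot => simp at hz2
        | top => simp at hz1
        | coe z =>
          have hz1' : z ≤ b := by exact_mod_cast hz1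
          have hz2' : a < z := by exact_mod_cast hz2
          refine hball ?_
          rw [Metric.mem_ball, Real.dist_eq, abs_lt]
          constructor <;> linarith
  · rintro _ ⟨A, hA, B, hB, rfl⟩
    have : Tendsto (fun N => (μ N : Measure EReal).real (A \ B)) atTop
        (𝓝 ((ν : Measure EReal).real (A \ B))) := by
      rcases hchain A hA B hB with hAB | hAB
      · rw [Set.sdiff_eq_empty.2 hAB]
        simp
      · have hd : ∀ ρ : ProbabilityMeasure EReal, (ρ : Measure EReal).real (A \ B) =
            (ρ : Measure EReal).real A - (ρ : Measure EReal).real B := fun ρ =>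
          measureReal_sdiff hAB (hmeas B hB)
        simp_rw [hd]
        exact (htend A hA).sub (htend B hB)
    rw [← NNReal.tendsto_coe]
    simpa using this

lemma exists_measureReal_Iic_lt (ν : ProbabilityMeasure EReal) {D : Set ℝ} (hD : Dense D) (t : ℝ)
    {ε : ℝ} (hε : 0 < ε) : ∃ t' ∈ D, t < t' ∧
      (ν : Measure EReal).real (Set.Iic (t' : EReal)) <
        (ν : Measure EReal).real (Set.Iic (t : EReal)) + ε := by
  obtain ⟨u, hu1, hu2, hu3⟩ := exists_seq_strictAnti_tendsto t
  have hI : ⋂ n, Set.Iic ((u n : ℝ) : EReal) = Set.Iic (t : EReal) := by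
    ext z
    simp only [Set.mem_iInter, Set.mem_Iic]
    constructor
    · intro hz
      exact ge_of_tendsto' ((continuous_coe_real_ereal.tendsto t).comp hu3) hz
    · exact fun hz n => hz.trans (by exact_mod_cast (hu2 n).le)
  have h1 := tendsto_measure_iInter_atTop (μ := (ν : Measure EReal))
    (s := fun n => Set.Iic ((u n : ℝ) : EReal))
    (fun n => measurableSet_Iic.nullMeasurableSet)
    (fun i j hij => Set.Iic_subset_Iic.2 (by exact_mod_cast hu1.antitone hij))
    ⟨0, measure_ne_top _ _⟩
  rw [hI] at h1
  have h2 := (ENNReal.tendsto_toReal (measure_ne_top _ _)).comp h1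
  obtain ⟨n, hn⟩ := (h2.eventually_lt_const (lt_add_of_pos_right _ hε)).exists
  obtain ⟨t', ht', h3, h4⟩ := hD.exists_between (hu2 n)
  refine ⟨t', ht', h3, lt_of_le_of_lt ?_ hn⟩
  exact measureReal_mono (Set.Iic_subset_Iic.2 (by exact_mod_cast h4.le))

/-- The upper bound concerns only the open ray, so it is applied at a slightly larger `t' ∈ D`;
right continuity of the limiting distribution function absorbs the shift. -/
lemma tendsto_probabilityMeasure_of_sandwich {D : Set ℝ} (hD : Dense D)
    {μ : ℕ → ProbabilityMeasure EReal} {ν : ProbabilityMeasure EReal} {lo hi : ℝ → ℕ → ℝ}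
    (hlo : ∀ t ∈ D, Tendsto (lo t) atTop (𝓝 ((ν : Measure EReal).real (Set.Iic (t : EReal)))))
    (hhi : ∀ t ∈ D, Tendsto (hi t) atTop (𝓝 ((ν : Measure EReal).real (Set.Iic (t : EReal)))))
    (hlo' : ∀ t ∈ D, ∀ᶠ N in atTop, lo t N ≤ (μ N : Measure EReal).real (Set.Iic (t : EReal)))
    (hhi' : ∀ t ∈ D, ∀ᶠ N in atTop, (μ N : Measure EReal).real (Set.Iio (t : EReal)) ≤ hi t N) :
    Tendsto μ atTop (𝓝 ν) := by
  refine tendsto_probabilityMeasure_ereal hD fun t ht => ?_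
  rw [tendsto_order]
  constructor
  · intro a ha
    filter_upwards [(hlo t ht).eventually_const_lt ha, hlo' t ht] with N h1 h2
    exact h1.trans_le h2
  · intro a ha
    obtain ⟨t', ht', htt', hlt⟩ := exists_measureReal_Iic_lt ν hD t (sub_pos.2 ha)
    rw [add_sub_cancel] at hlt
    filter_upwards [(hhi t' ht').eventually_lt_const hlt, hhi' t' ht'] with N h1 h2
    refine lt_of_le_of_lt (measureReal_mono ?_) (h2.trans_lt h1)
    exact fun z hz => lt_of_le_of_lt (Set.mem_Iic.1 hz) (EReal.coe_lt_coe_iff.2 htt')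

/-! ### Probabilities of threshold events -/

lemma expect_mul_sub (p N : ℕ) (β h r κ : ℝ) (f : ℝ → ℝ) :
    expect p N β h (fun x => r * (f x - κ)) = r * (expect p N β h f - κ) := by
  have h1 : ∀ X : Config N, prob p N β h X * (r * (f (mag X) - κ)) =
      r * (prob p N β h X * f (mag X)) - r * κ * prob p N β h X := fun X => by ring
  simp only [expect, h1, Finset.sum_sub_distrib, ← Finset.mul_sum, sum_prob]
  ring

/-- After centring at `κ` and scaling by `r N`, the comparison of `x^p` with `u N` is eventually
decided by that of `γ w` with `a`, except on the null set `γ w = a`. That set also hides the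
difference between `<` and `≤`. An extended real `a` allows thresholds that escape to infinity. -/
lemma IsNondegenerateMax.tendsto_expect_threshold {p : ℕ} (hp : 0 < p) {β h m q κ : ℝ}
    (hH : IsNondegenerateMax p β h m q) {r u : ℕ → ℝ} {γ : ℝ → ℝ} {a : EReal}
    (hγ : ∀ (w : ℝ) (x : ℕ → ℝ), Tendsto (fun N : ℕ => √N * (x N - m)) atTop (𝓝 w) →
      Tendsto (fun N => r N * (x N ^ p - κ)) atTop (𝓝 (γ w)))
    (hγm : Measurable γ) (hr : ∀ᶠ N in atTop, 0 < r N)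
    (ha : Tendsto (fun N => ((r N * (u N - κ) : ℝ) : EReal)) atTop (𝓝 a))
    (hnull : ∀ᵐ w : ℝ, (γ w : EReal) ≠ a) :
    Tendsto (fun N => expect p N β h ({x | x ^ p < u N}.indicator fun _ => 1)) atTop
      (𝓝 ((gaussianReal 0 (limitVar q)).real {w | (γ w : EReal) ≤ a})) ∧
    Tendsto (fun N => expect p N β h ({x | x ^ p ≤ u N}.indicator fun _ => 1)) atTop
      (𝓝 ((gaussianReal 0 (limitVar q)).real {w | (γ w : EReal) ≤ a})) := by
  have hmeas : MeasurableSet {w | (γ w : EReal) ≤ a} :=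
    measurableSet_le (measurable_coe_real_ereal.comp hγm) measurable_const
  have hbound : ∀ (S : ℕ → Set ℝ), ∀ N, ∀ x ∈ Set.Icc (-1 : ℝ) 1,
      |(S N).indicator (fun _ => (1 : ℝ)) x| ≤ 1 * Real.exp (1 * (√N * |x - m|)) := by
    intro S N x _
    have h1 : 1 ≤ Real.exp (1 * (√N * |x - m|)) := Real.one_le_exp (by positivity)
    rw [one_mul]
    refine le_trans ?_ h1
    by_cases hx : x ∈ S N
    · simp [hx]
    · simp [hx]
  have hlt : ∀ (w : ℝ) (x : ℕ → ℝ), Tendsto (fun N : ℕ => √N * (x N - m)) atTop (𝓝 w) →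
      (γ w : EReal) < a → ∀ᶠ N in atTop, x N ^ p < u N := by
    intro w x hx hwa
    filter_upwards [((continuous_coe_real_ereal.tendsto _).comp (hγ w x hx)).eventually_lt ha hwa,
      hr] with N h1 h2
    have h3 : r N * (x N ^ p - κ) < r N * (u N - κ) := EReal.coe_lt_coe_iff.1 h1
    linarith [lt_of_mul_lt_mul_left h3 h2.le]
  have hgt : ∀ (w : ℝ) (x : ℕ → ℝ), Tendsto (fun N : ℕ => √N * (x N - m)) atTop (𝓝 w) →
      a < (γ w : EReal) → ∀ᶠ N in atTop, u N < x N ^ p := by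
    intro w x hx hwa
    filter_upwards [ha.eventually_lt ((continuous_coe_real_ereal.tendsto _).comp (hγ w x hx)) hwa,
      hr] with N h1 h2
    have h3 : r N * (u N - κ) < r N * (x N ^ p - κ) := EReal.coe_lt_coe_iff.1 h1
    linarith [lt_of_mul_lt_mul_left h3 h2.le]
  have hint : (gaussianReal 0 (limitVar q)).real {w | (γ w : EReal) ≤ a} =
      ∫ w, {w | (γ w : EReal) ≤ a}.indicator (fun _ => (1 : ℝ)) w
        ∂(gaussianReal 0 (limitVar q)) := by
    rw [integral_indicator hmeas]
    simp
  have main : ∀ (S : ℕ → Set ℝ), (∀ N x, x ^ p < u N → x ∈ S N) →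
      (∀ N x, u N < x ^ p → x ∉ S N) →
      Tendsto (fun N => expect p N β h ((S N).indicator fun _ => 1)) atTop
        (𝓝 ((gaussianReal 0 (limitVar q)).real {w | (γ w : EReal) ≤ a})) := by
    intro S hS1 hS2
    rw [hint]
    refine hH.tendsto_expect hp (A := 1) (hbound S) ?_
    filter_upwards [hnull] with w hw x hx
    rcases lt_or_gt_of_ne hw with h1 | h1
    · rw [Set.indicator_of_mem (by exact h1.le)]
      refine tendsto_const_nhds.congr' ?_
      filter_upwards [hlt w x hx h1] with N hN
      rw [Set.indicator_of_mem (hS1 N _ hN)]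
    · rw [Set.indicator_of_notMem (by exact not_le.2 h1)]
      refine tendsto_const_nhds.congr' ?_
      filter_upwards [hgt w x hx h1] with N hN
      rw [Set.indicator_of_notMem (hS2 N _ hN)]
  exact ⟨main (fun N => {x | x ^ p < u N}) (fun _ _ h => h) fun _ _ h => not_lt.2 h.le,
    main (fun N => {x | x ^ p ≤ u N}) (fun _ _ h => h.le) fun _ _ h => not_le.2 h⟩

/-! ### Moments beyond the threshold -/

lemma partitionFn_zero (p N : ℕ) : partitionFn p N 0 0 = 1 := by
  simp [partitionFn, energy, Fintype.card_units_int]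

lemma peakWeight_mul_exp_le_partitionFn {p N k : ℕ} (hp : 0 < p) (hN : 0 < N) (hk : k ≤ N)
    (β h : ℝ) :
    peakWeight N k * Real.exp (N * H p β h (gridPoint N k)) ≤ partitionFn p N β h := by
  have h1 := sum_exp_energy_mul hp hN β h fun _ => 1
  simp only [mul_one] at h1
  rw [partitionFn, one_div_mul_eq_div, h1]
  exact Finset.single_le_sum
    (f := fun k => peakWeight N k * Real.exp (N * H p β h (gridPoint N k)))
    (fun j _ => mul_nonneg (peakWeight_nonneg N j) (Real.exp_pos _).le)
    (Finset.mem_range.2 (Nat.lt_succ_of_le hk))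

/-- Beyond the threshold the expected power of the magnetization stays away from zero. -/
lemma exists_eventually_le_mul_expect {p : ℕ} (hp : 0 < p) {t : ℝ}
    (ht : ∃ x ∈ Set.Icc (-1 : ℝ) 1, entropy x < t * x ^ p) :
    ∃ η > 0, ∀ᶠ N in atTop, η ≤ t * expect p N t 0 fun x => x ^ p := by
  obtain ⟨x, hx, hx0⟩ := ht
  have hopen : IsOpen {x | entropy x < t * x ^ p} :=
    isOpen_lt continuous_entropy (by fun_prop)
  -- Strict inequality is an open condition, so the witness can be moved off the endpoints, where
  -- the Stirling estimate is unavailable.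
  rw [← closure_Ioo (by norm_num : (-1 : ℝ) ≠ 1)] at hx
  obtain ⟨y, hy0, hy⟩ := mem_closure_iff.1 hx _ hopen hx0
  have hHy : 0 < H p t 0 y := by
    have : entropy y < t * y ^ p := hy0
    rw [H]; linarith
  have hcell := tendsto_cell hy 0
  have hgrid := tendsto_of_tendsto_sqrt_mul hcell
  have hpw := tendsto_sqrt_mul_peakWeight hy hgrid
  have hNt : Tendsto (fun N : ℕ => (N : ℝ)) atTop atTop := tendsto_natCast_atTop_atTop
  have h1 : Tendsto (fun N : ℕ => Real.log (√N * peakWeight N (cellIndex y N 0)) / N) atTop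
      (𝓝 0) := (hpw.log (peakLimit_pos hy).ne').div_atTop hNt
  have h2 : Tendsto (fun N : ℕ => Real.log N / N) atTop (𝓝 0) :=
    Real.isLittleO_log_id_atTop.tendsto_div_nhds_zero.comp hNt
  have h3 := ((h1.sub (h2.div_const 2)).add (((continuous_H p t 0).tendsto y).comp hgrid))
  rw [zero_div, sub_zero, zero_add] at h3
  refine ⟨H p t 0 y / 2, by positivity, ?_⟩
  filter_upwards [h3.eventually_const_le (show H p t 0 y / 2 < H p t 0 y by linarith),
    eventually_gt_atTop 0, eventually_mem_cells hy 0,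
    hpw.eventually_const_lt (peakLimit_pos hy)] with N h4 hN hmem hpos
  refine h4.trans ?_
  have hN' : (0 : ℝ) < N := by positivity
  have hle := (peakWeight_mul_exp_le_partitionFn hp hN (cellIndex_le hmem) t 0)
  -- Jensen at parameter `0`, where the partition function is `1`, gives `log Z(t) ≤ N t E_t[x^p]`.
  -- A single grid term near `y` gives `log Z(t) ≥ N H(y) - o(N)`.
  have hJ := partitionFn_mul_exp_le (N := N) hp t 0 0
  rw [partitionFn_zero] at hJ
  have hZ : partitionFn p N t 0 ≤ Real.exp (N * (t * expect p N t 0 fun x => x ^ p)) := by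
    have := mul_le_mul_of_nonneg_right hJ
      (Real.exp_pos (N * (t * expect p N t 0 fun x => x ^ p))).le
    rw [mul_assoc, ← Real.exp_add, one_mul] at this
    refine le_trans (le_of_eq ?_) this
    rw [show (0 - t) * (N * expect p N t 0 fun x => x ^ p) +
      N * (t * expect p N t 0 fun x => x ^ p) = 0 by ring, Real.exp_zero, mul_one]
  have hpwpos : 0 < peakWeight N (cellIndex y N 0) :=
    pos_of_mul_pos_right hpos (Real.sqrt_nonneg _)
  have hlog := Real.log_le_log (by positivity) (hle.trans hZ)
  rw [Real.log_exp, Real.log_mul hpwpos.ne' (Real.exp_pos _).ne', Real.log_exp] at hlog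
  have hsq : Real.log (√N * peakWeight N (cellIndex y N 0)) =
      Real.log N / 2 + Real.log (peakWeight N (cellIndex y N 0)) := by
    rw [Real.log_mul (by positivity) hpwpos.ne', Real.log_sqrt hN'.le]
  simp only [Function.comp_apply]
  rw [hsq]
  refine le_of_mul_le_mul_left (le_trans (le_of_eq ?_) hlog) hN'
  field_simp
  ring

lemma tendsto_sqrt_natCast_pow {p : ℕ} (hp : 0 < p) :
    Tendsto (fun N : ℕ => √(N : ℝ) ^ p) atTop atTop :=
  (tendsto_pow_atTop hp.ne').comp (Real.tendsto_sqrt_atTop.comp tendsto_natCast_atTop_atTop)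

lemma tendsto_mul_mul_expect_atTop {p : ℕ} (hp : 0 < p) {t : ℝ}
    (ht : ∃ x ∈ Set.Icc (-1 : ℝ) 1, entropy x < t * x ^ p) :
    Tendsto (fun N : ℕ => t * (√N ^ p * expect p N t 0 fun x => x ^ p)) atTop atTop := by
  obtain ⟨η, hη, h⟩ := exists_eventually_le_mul_expect hp ht
  refine tendsto_atTop_mono' _ ?_ ((tendsto_sqrt_natCast_pow hp).atTop_mul_const hη)
  filter_upwards [h] with N hN
  calc √(N : ℝ) ^ p * η ≤ √(N : ℝ) ^ p * (t * expect p N t 0 fun x => x ^ p) := by gcongr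
    _ = _ := by ring

lemma tendsto_expect_top {p : ℕ} (hp : 3 ≤ p) {t : ℝ} (ht : betaTilde p < t) :
    Tendsto (fun N : ℕ => ((√N ^ p * ((expect p N t 0 fun x => x ^ p) - 0) : ℝ) : EReal)) atTop
      (𝓝 ⊤) := by
  have htpos := (betaTilde_pos hp).trans ht
  have h := (tendsto_mul_mul_expect_atTop (by omega) (exists_entropy_lt hp ht)).const_mul_atTop
    (inv_pos.2 htpos)
  refine EReal.tendsto_coe_nhds_top_iff.2 (h.congr fun N => ?_)
  field_simp
  ring

/-- For odd `p`, the reflection `x ↦ -x` turns `t` into `-t`, which lies beyond the threshold. -/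
lemma tendsto_expect_bot {p : ℕ} (hp : 3 ≤ p) (ho : Odd p) {t : ℝ} (ht : t < -betaTilde p) :
    Tendsto (fun N : ℕ => ((√N ^ p * ((expect p N t 0 fun x => x ^ p) - 0) : ℝ) : EReal)) atTop
      (𝓝 ⊥) := by
  have htneg : t < 0 := by linarith [betaTilde_pos hp]
  have hex : ∃ x ∈ Set.Icc (-1 : ℝ) 1, entropy x < t * x ^ p := by
    obtain ⟨x, hx, hx0⟩ := exists_entropy_lt hp (show betaTilde p < -t by linarith)
    refine ⟨-x, ⟨by linarith [hx.2], by linarith [hx.1]⟩, ?_⟩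
    rwa [entropy_neg, ho.neg_pow, mul_neg, ← neg_mul]
  have h := (tendsto_mul_mul_expect_atTop (by omega) hex).const_mul_atTop_of_neg
    (inv_lt_zero.2 htneg)
  refine EReal.tendsto_coe_nhds_bot_iff.2 (h.congr fun N => ?_)
  have := htneg.ne
  field_simp
  ring

/-! ### Limit law when the maximizer vanishes -/

/-- The redundant `p!` in the exponent matches the growth condition `A * exp (A * y)`, which uses
one constant twice. -/
lemma pow_le_factorial_mul_exp (p : ℕ) {y : ℝ} (hy : 0 ≤ y) :
    y ^ p ≤ p.factorial * Real.exp (p.factorial * y) := by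
  have h1 := Real.pow_div_factorial_le_exp y hy p
  rw [div_le_iff₀ (by positivity)] at h1
  have h2 : y ≤ p.factorial * y :=
    le_mul_of_one_le_left hy (by exact_mod_cast p.factorial_pos)
  calc y ^ p ≤ Real.exp y * p.factorial := h1
    _ ≤ Real.exp (p.factorial * y) * p.factorial := by gcongr
    _ = _ := mul_comm _ _

lemma limitVar_neg_one : limitVar (-1) = 1 := by simp [limitVar]

lemma tendsto_sqrt_pow_mul {p : ℕ} {w : ℝ} {x : ℕ → ℝ}
    (hx : Tendsto (fun N : ℕ => √N * (x N - 0)) atTop (𝓝 w)) :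
    Tendsto (fun N : ℕ => √N ^ p * (x N ^ p - 0)) atTop (𝓝 (w ^ p)) := by
  refine (hx.pow p).congr fun N => ?_
  rw [mul_pow, sub_zero, sub_zero]

lemma tendsto_expect_moment {p : ℕ} (hp : 3 ≤ p) {t : ℝ} (ht : IsUniqueMaximizer p t 0 0) :
    Tendsto (fun N : ℕ => ((√N ^ p * ((expect p N t 0 fun x => x ^ p) - 0) : ℝ) : EReal)) atTop
      (𝓝 ((∫ y, y ^ p ∂(gaussianReal 0 1) : ℝ) : EReal)) := by
  refine (continuous_coe_real_ereal.tendsto _).comp ?_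
  have h := (isNondegenerateMax_zero hp ht).tendsto_expect (by omega) (A := p.factorial)
    (F := fun N x => √N ^ p * (x ^ p - 0)) (φ := fun w => w ^ p) ?_
    (Eventually.of_forall fun w x hx => tendsto_sqrt_pow_mul hx)
  · rw [limitVar_neg_one] at h
    simpa only [expect_mul_sub] using h
  · intro N x _
    rw [sub_zero, sub_zero, ← mul_pow, abs_pow, abs_mul, abs_of_nonneg (Real.sqrt_nonneg _)]
    exact pow_le_factorial_mul_exp p (by positivity)

lemma ae_pow_ne {p : ℕ} (hp : 0 < p) (a : EReal) :
    ∀ᵐ w : ℝ, ((w ^ p : ℝ) : EReal) ≠ a := by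
  induction a with
  | bot => exact Eventually.of_forall fun w => EReal.coe_ne_bot _
  | top => exact Eventually.of_forall fun w => EReal.coe_ne_top _
  | coe a =>
    have hfin : {w : ℝ | w ^ p = a}.Finite := by
      refine ((Polynomial.nthRoots p a).toFinset.finite_toSet).subset fun w hw => ?_
      simpa [Polynomial.mem_nthRoots hp] using hw
    filter_upwards [compl_mem_ae_iff.2 (hfin.measure_zero volume)] with w hw hcon
    exact hw (by exact_mod_cast hcon)

/-- If the maximizer vanishes, distribution functions of the estimate converge. -/
lemma tendsto_law_of_maximizer_zero {p : ℕ} (hp : 3 ≤ p) {β : ℝ}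
    (hm : IsUniqueMaximizer p β 0 0) {betaHat : ∀ N : ℕ, Config N → EReal}
    (hmle : ∀ (N : ℕ) (X : Config N), IsMLE p N 0 X (betaHat N X)) {D : Set ℝ} (hD : Dense D)
    {ν : ProbabilityMeasure EReal} {a : ℝ → EReal}
    (ha : ∀ t ∈ D, Tendsto
      (fun N : ℕ => ((√N ^ p * ((expect p N t 0 fun x => x ^ p) - 0) : ℝ) : EReal)) atTop
      (𝓝 (a t)))
    (hν : ∀ t ∈ D, (gaussianReal 0 1).real {w : ℝ | ((w ^ p : ℝ) : EReal) ≤ a t} =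
      (ν : Measure EReal).real (Set.Iic (t : EReal))) :
    ConvergesInLaw p β 0 betaHat ν := by
  have hp0 : 0 < p := by omega
  have key := fun t (ht : t ∈ D) => (isNondegenerateMax_zero hp hm).tendsto_expect_threshold hp0
    (γ := fun w => w ^ p) (fun w x hx => tendsto_sqrt_pow_mul hx) (by fun_prop)
    ((tendsto_sqrt_natCast_pow hp0).eventually_gt_atTop 0) (ha t ht) (ae_pow_ne hp0 (a t))
  rw [limitVar_neg_one] at key
  refine tendsto_probabilityMeasure_of_sandwich hD
    (fun t ht => by rw [← hν t ht]; exact (key t ht).1)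
    (fun t ht => by rw [← hν t ht]; exact (key t ht).2) ?_ ?_
  · intro t _
    filter_upwards [eventually_gt_atTop 0] with N hN
    exact expect_lt_le_law_real hp0 hN (hmle N) measurableSet_Iic fun X hX => hX
  · intro t _
    filter_upwards [eventually_gt_atTop 0] with N hN
    exact law_real_le_expect_le hp0 hN (hmle N) measurableSet_Iio fun X hX => hX

lemma twoPoint_real_Iic (w : unitInterval) (a b t : EReal) :
    (twoPoint w a b : Measure EReal).real (Set.Iic t) =
      w * (Set.Iic t).indicator (fun _ => (1 : ℝ)) a +
        (1 - w) * (Set.Iic t).indicator (fun _ => (1 : ℝ)) b := by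
  have hw := w.2
  change (ENNReal.ofReal w • Measure.dirac a + ENNReal.ofReal (1 - w) • Measure.dirac b).real
    (Set.Iic t) = _
  rw [measureReal_def, Measure.add_apply, Measure.smul_apply, Measure.smul_apply,
    Measure.dirac_apply' _ measurableSet_Iic, Measure.dirac_apply' _ measurableSet_Iic]
  have hw1 := hw.1
  have hw2 := sub_nonneg.2 hw.2
  by_cases h1 : a ∈ Set.Iic t <;> by_cases h2 : b ∈ Set.Iic t <;>
    simp only [h1, h2, Set.indicator_of_mem, Set.indicator_of_notMem, not_false_eq_true,
      Pi.one_apply, smul_eq_mul, mul_one, mul_zero, add_zero, zero_add, ENNReal.toReal_zero,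
      ENNReal.toReal_ofReal hw1, ENNReal.toReal_ofReal hw2,
      ENNReal.toReal_add ENNReal.ofReal_ne_top ENNReal.ofReal_ne_top]

lemma gaussianReal_real_Iic_zero : (gaussianReal 0 1).real (Set.Iic 0) = 1 / 2 := by
  have h1 : (gaussianReal 0 1).real (Set.Iic 0) = (gaussianReal 0 1).real (Set.Ici 0) := by
    have h2 := gaussianReal_map_neg (μ := 0) (v := 1)
    rw [neg_zero] at h2
    conv_rhs => rw [← h2]
    rw [map_measureReal_apply measurable_neg measurableSet_Ici]
    congr 1
    ext x
    simp
  have hna : NullSingletonClass (gaussianReal 0 1) := nullSingletonClass_gaussianReal one_ne_zero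
  have h3 : (gaussianReal 0 1).real (Set.Ici 0) = (gaussianReal 0 1).real (Set.Ioi 0) :=
    measureReal_congr Ioi_ae_eq_Ici.symm
  have h4 := probReal_add_probReal_compl (μ := gaussianReal 0 1) (s := Set.Iic 0) measurableSet_Iic
  rw [Set.compl_Iic] at h4
  linarith

lemma dense_compl_pair (a b : ℝ) : Dense ({a, b}ᶜ : Set ℝ) :=
  (Set.toFinite {a, b}).countable.dense_compl ℝ

lemma integral_odd_pow_gaussianReal {p : ℕ} (ho : Odd p) : ∫ y, y ^ p ∂(gaussianReal 0 1) = 0 := by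
  have h2 := gaussianReal_map_neg (μ := 0) (v := 1)
  rw [neg_zero] at h2
  have h3 : ∫ y, y ^ p ∂(gaussianReal 0 1) = ∫ y, (-y) ^ p ∂(gaussianReal 0 1) := by
    conv_lhs => rw [← h2]
    exact integral_map measurable_neg.aemeasurable (by fun_prop)
  simp_rw [ho.neg_pow, integral_neg] at h3
  linarith

lemma convergesInLaw_of_odd {p : ℕ} (hp : 3 ≤ p) (ho : Odd p) {β : ℝ}
    (hm : IsUniqueMaximizer p β 0 0) {betaHat : ∀ N : ℕ, Config N → EReal}
    (hmle : ∀ (N : ℕ) (X : Config N), IsMLE p N 0 X (betaHat N X)) :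
    ConvergesInLaw p β 0 betaHat
      (twoPoint oneHalf ((betaTilde p : ℝ) : EReal) ((-betaTilde p : ℝ) : EReal)) := by
  classical
  have hb := betaTilde_pos hp
  -- The limiting threshold is `+∞` above `β̃`, `-∞` below `-β̃`, and `E Z^p = 0` in between, where
  -- the distribution function is `P(Z^p ≤ 0) = 1/2`. The two atoms are left out of `D`.
  refine tendsto_law_of_maximizer_zero hp hm hmle (dense_compl_pair (betaTilde p) (-betaTilde p))
    (a := fun t => if betaTilde p < t then ⊤ else if t < -betaTilde p then ⊥ else 0) ?_ ?_
  · intro t ht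
    simp only [Set.mem_compl_iff, Set.mem_insert_iff, Set.mem_singleton_iff, not_or] at ht
    split_ifs with h1 h2
    · exact tendsto_expect_top hp h1
    · exact tendsto_expect_bot hp ho h2
    · have := tendsto_expect_moment hp (isUniqueMaximizer_zero_of_odd ho (t := t) (abs_lt.2
        ⟨lt_of_le_of_ne (not_lt.1 h2) (Ne.symm ht.2), lt_of_le_of_ne (not_lt.1 h1) ht.1⟩))
      rwa [integral_odd_pow_gaussianReal ho, EReal.coe_zero] at this
  · intro t ht
    simp only [Set.mem_compl_iff, Set.mem_insert_iff, Set.mem_singleton_iff, not_or] at ht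
    rw [twoPoint_real_Iic]
    simp only [Set.indicator, Set.mem_Iic, EReal.coe_le_coe_iff, oneHalf]
    rcases lt_trichotomy t (-betaTilde p) with h1 | h1 | h1
    · have h2 : ¬ betaTilde p < t := by linarith
      have h3 : ¬ betaTilde p ≤ t := by linarith
      rw [if_neg h2, if_pos h1, if_neg h3, if_neg h1.not_ge]
      simp only [le_bot_iff, EReal.coe_ne_bot, Set.ofPred_false, measureReal_empty]
      norm_num
    · exact absurd h1 ht.2
    rcases lt_trichotomy t (betaTilde p) with h2 | h2 | h2
    · have hset : {w : ℝ | ((w ^ p : ℝ) : EReal) ≤ 0} = Set.Iic 0 := by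
        ext w
        rw [Set.mem_ofPred_eq, ← EReal.coe_zero, EReal.coe_le_coe_iff, Set.mem_Iic,
          ho.pow_nonpos_iff]
      rw [if_neg h2.not_gt, if_neg h1.not_gt, hset, gaussianReal_real_Iic_zero, if_neg h2.not_ge,
        if_pos h1.le]
      norm_num
    · exact absurd h2 ht.1
    · simp only [h2, h2.le, h1.le, if_true, le_top]
      simp

lemma convergesInLaw_of_even {p : ℕ} (hp : 3 ≤ p) (he : Even p) {β : ℝ}
    (hm : IsUniqueMaximizer p β 0 0) {betaHat : ∀ N : ℕ, Config N → EReal}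
    (hmle : ∀ (N : ℕ) (X : Config N), IsMLE p N 0 X (betaHat N X)) :
    ConvergesInLaw p β 0 betaHat (twoPoint (gammaP p) ⊥ ((betaTilde p : ℝ) : EReal)) := by
  classical
  -- For even `p` the threshold stays at `E Z^p` for every `t < β̃`, however negative, so the
  -- distribution function equals `γ_p` down to `-∞`.
  refine tendsto_law_of_maximizer_zero hp hm hmle (dense_compl_pair (betaTilde p) (betaTilde p))
    (a := fun t => if betaTilde p < t then ⊤ else
      ((∫ y, y ^ p ∂(gaussianReal 0 1) : ℝ) : EReal)) ?_ ?_
  · intro t ht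
    simp only [Set.mem_compl_iff, Set.mem_insert_iff, Set.mem_singleton_iff, or_self] at ht
    split_ifs with h1
    · exact tendsto_expect_top hp h1
    · exact tendsto_expect_moment hp (isUniqueMaximizer_zero_of_even (by omega) he
        (lt_of_le_of_ne (not_lt.1 h1) ht))
  · intro t ht
    simp only [Set.mem_compl_iff, Set.mem_insert_iff, Set.mem_singleton_iff, or_self] at ht
    rw [twoPoint_real_Iic]
    by_cases h1 : betaTilde p < t
    · simp [h1, h1.le]
    · have h2 : ¬ betaTilde p ≤ t := fun h => h1 (lt_of_le_of_ne h (Ne.symm ht))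
      simp only [h1, if_false, EReal.coe_le_coe_iff]
      simp [h2, gammaP]

/-! ### Limit law when the maximizer is nonzero -/

/-- Derivative at `a` of the moment generating function `exp (v a² / 2)`: the Gaussian tilted by
`exp (a w)` has mean `v a`. -/
lemma gaussian_integral_exp_mul_id (v : NNReal) (a : ℝ) :
    ∫ w, Real.exp (a * w) * w ∂(gaussianReal 0 v) =
      v * a * ∫ w, Real.exp (a * w) ∂(gaussianReal 0 v) := by
  have h1 := deriv_mgf (X := id) (μ := gaussianReal 0 v) (t := a) (by
    rw [integrableExpSet_id_gaussianReal, interior_univ]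
    trivial)
  have h2 : ∫ w, Real.exp (a * w) ∂(gaussianReal 0 v) = mgf id (gaussianReal 0 v) a := rfl
  have h3 : HasDerivAt (fun t : ℝ => Real.exp (0 * t + v * t ^ 2 / 2))
      (Real.exp (0 * a + v * a ^ 2 / 2) * (v * a)) a := by
    have h4 := (((hasDerivAt_id a).const_mul 0).add
      ((((hasDerivAt_id a).pow 2).const_mul (v : ℝ)).div_const 2)).exp
    refine h4.congr_deriv ?_
    simp
    ring
  rw [mgf_id_gaussianReal, h3.deriv] at h1
  rw [h2, mgf_id_gaussianReal]
  simp only [id] at h1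
  rw [mul_comm (v * a : ℝ), h1]
  exact integral_congr_ae (Eventually.of_forall fun w => mul_comm _ _)

lemma integral_exp_mul_gaussianReal_pos (v : NNReal) (a : ℝ) :
    0 < ∫ w, Real.exp (a * w) ∂(gaussianReal 0 v) := by
  have h2 : ∫ w, Real.exp (a * w) ∂(gaussianReal 0 v) = mgf id (gaussianReal 0 v) a := rfl
  rw [h2, mgf_id_gaussianReal]
  exact Real.exp_pos _

lemma tendsto_sqrt_mul_pow_sub {p : ℕ} {m w : ℝ} {x : ℕ → ℝ}
    (hx : Tendsto (fun N : ℕ => √N * (x N - m)) atTop (𝓝 w)) :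
    Tendsto (fun N : ℕ => √N * (x N ^ p - m ^ p)) atTop (𝓝 (p * m ^ (p - 1) * w)) := by
  have h0 := (hasDerivAt_pow p m).isLittleO.comp_tendsto (tendsto_of_tendsto_sqrt_mul hx)
  have h1 := (Asymptotics.isBigO_refl (fun N : ℕ => √(N : ℝ)) atTop).mul_isLittleO h0
  have h2 := (h1.trans_isBigO (hx.isBigO_one ℝ)).tendsto_zero_of_tendsto tendsto_const_nhds
  have h3 := h2.add (hx.const_mul (p * m ^ (p - 1)))
  rw [zero_add] at h3
  refine h3.congr fun N => ?_
  simp only [Function.comp, smul_eq_mul]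
  ring

lemma abs_pow_sub_pow_le_of_mem {p : ℕ} {x m : ℝ} (hx : x ∈ Set.Icc (-1 : ℝ) 1)
    (hm : m ∈ Set.Ioo (-1 : ℝ) 1) : |x ^ p - m ^ p| ≤ p * |x - m| := by
  have h1 : max |x| |m| ^ (p - 1) ≤ 1 :=
    pow_le_one₀ (by positivity) (max_le (abs_le.2 hx) (abs_lt.2 hm).le)
  calc |x ^ p - m ^ p| ≤ |x - m| * p * max |x| |m| ^ (p - 1) := abs_pow_sub_pow_le ..
    _ ≤ |x - m| * p * 1 := by gcongr
    _ = _ := by ring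

/-- The response of the rescaled moment to a perturbation of order `1 / √N` of the parameter. -/
lemma IsNondegenerateMax.tendsto_expect_response {p : ℕ} (hp : 0 < p) {β h m q : ℝ}
    (hH : IsNondegenerateMax p β h m q) (s : ℝ) :
    Tendsto (fun N : ℕ => √N * ((expect p N (β + s / √N) h fun x => x ^ p) - m ^ p)) atTop
      (𝓝 (s * (p * m ^ (p - 1)) ^ 2 * limitVar q)) := by
  set κ : ℝ := p * m ^ (p - 1) with hκ
  have hb : ∀ N : ℕ, (N : ℝ) * (β + s / √N - β) = s * √N := by
    intro N
    rcases Nat.eq_zero_or_pos N with rfl | hN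
    · simp
    · have h0 : √(N : ℝ) ≠ 0 := by positivity
      rw [add_sub_cancel_left, mul_div_assoc', div_eq_iff h0, mul_assoc,
        Real.mul_self_sqrt (by positivity), mul_comm]
  -- `A` must dominate the prefactor `p` and the rate `|s| p + 1`, whose extra `1` comes from
  -- bounding `√N |x - m|` by its exponential.
  set A : ℝ := (|s| + 1) * p + 1 with hA
  have hp1 : (1 : ℝ) ≤ p := by exact_mod_cast hp
  have hAp : (p : ℝ) ≤ A := by nlinarith [abs_nonneg s]
  have hA1 : 1 ≤ A := by linarith
  have hexp : ∀ N : ℕ, ∀ x ∈ Set.Icc (-1 : ℝ) 1,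
      Real.exp (s * √N * (x ^ p - m ^ p)) ≤ Real.exp (|s| * p * (√N * |x - m|)) := by
    intro N x hx
    refine Real.exp_le_exp.2 ((le_abs_self _).trans ?_)
    rw [abs_mul, abs_mul, abs_of_nonneg (Real.sqrt_nonneg _)]
    calc |s| * √N * |x ^ p - m ^ p| ≤ |s| * √N * (p * |x - m|) := by
          gcongr
          exact abs_pow_sub_pow_le_of_mem hx hH.mem
      _ = _ := by ring
  -- The shift `s / √N` tilts the limiting Gaussian by `exp (s κ w)`, which moves its mean to `s κ
  -- v`; the observable `κ w` then averages to `s κ² v`.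
  have hmain := hH.tendsto_expect_tilted hp (A := A) (s := m ^ p) (b := fun N => β + s / √N)
    (F := fun N x => √N * (x ^ p - m ^ p)) (φ := fun w => κ * w) (ψ := fun w => s * κ * w)
    ?_ ?_ ?_ (Eventually.of_forall fun w x hx => tendsto_sqrt_mul_pow_sub hx)
    (integral_exp_mul_gaussianReal_pos _ _).ne'
  · have hcalc : (∫ w, Real.exp (s * κ * w) * (κ * w) ∂(gaussianReal 0 (limitVar q))) =
        s * κ ^ 2 * limitVar q * ∫ w, Real.exp (s * κ * w) ∂(gaussianReal 0 (limitVar q)) := by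
      simp_rw [mul_left_comm _ κ]
      rw [integral_const_mul, gaussian_integral_exp_mul_id]
      ring
    rw [hcalc, mul_div_cancel_right₀ _ (integral_exp_mul_gaussianReal_pos _ _).ne'] at hmain
    simpa only [expect_mul_sub] using hmain
  · intro N x hx
    have hy : 0 ≤ √N * |x - m| := by positivity
    rw [hb, abs_mul, abs_of_pos (Real.exp_pos _), abs_mul, abs_of_nonneg (Real.sqrt_nonneg _)]
    calc Real.exp (s * √N * (x ^ p - m ^ p)) * (√N * |x ^ p - m ^ p|)
        ≤ Real.exp (|s| * p * (√N * |x - m|)) * (√N * (p * |x - m|)) := by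
          have h1 := hexp N x hx
          have h2 := abs_pow_sub_pow_le_of_mem (p := p) hx hH.mem
          exact mul_le_mul h1 (mul_le_mul_of_nonneg_left h2 (Real.sqrt_nonneg _)) (by positivity)
            (Real.exp_pos _).le
      _ = p * (Real.exp (|s| * p * (√N * |x - m|)) * (√N * |x - m|)) := by ring
      _ ≤ A * (Real.exp (|s| * p * (√N * |x - m|)) * Real.exp (√N * |x - m|)) := by
          gcongr
          linarith [Real.add_one_le_exp (√N * |x - m|)]
      _ = A * Real.exp ((|s| * p + 1) * (√N * |x - m|)) := by
          rw [← Real.exp_add]; ring_nf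
      _ ≤ A * Real.exp (A * (√N * |x - m|)) := by
          gcongr
          nlinarith
  · intro N x hx
    rw [hb, abs_of_pos (Real.exp_pos _)]
    calc Real.exp (s * √N * (x ^ p - m ^ p)) ≤ Real.exp (|s| * p * (√N * |x - m|)) := hexp N x hx
      _ ≤ Real.exp (A * (√N * |x - m|)) := by
          gcongr
          nlinarith
      _ ≤ _ := le_mul_of_one_le_left (Real.exp_pos _).le hA1
  · intro w x hx
    simp_rw [hb]
    have h1 := (tendsto_sqrt_mul_pow_sub (p := p) hx).const_mul s
    rw [← mul_assoc, ← hκ] at h1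
    exact h1.congr fun N => (mul_assoc _ _ _).symm

lemma coe_mul_sub_le_iff {r : ℝ} (hr : 0 < r) (b : EReal) (β s : ℝ) :
    (r : EReal) * (b - β) ≤ s ↔ b ≤ ((β + s / r : ℝ) : EReal) := by
  induction b with
  | bot => simp [EReal.coe_mul_bot_of_pos hr]
  | top =>
    rw [EReal.top_sub_coe, EReal.coe_mul_top_of_pos hr]
    simp only [top_le_iff, EReal.coe_ne_top]
  | coe b =>
    rw [← EReal.coe_sub, ← EReal.coe_mul, EReal.coe_le_coe_iff, EReal.coe_le_coe_iff,
      ← sub_le_iff_le_add', le_div_iff₀' hr]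

lemma coe_mul_sub_lt_iff {r : ℝ} (hr : 0 < r) (b : EReal) (β s : ℝ) :
    (r : EReal) * (b - β) < s ↔ b < ((β + s / r : ℝ) : EReal) := by
  induction b with
  | bot => simp [EReal.coe_mul_bot_of_pos hr]
  | top =>
    rw [EReal.top_sub_coe, EReal.coe_mul_top_of_pos hr]
    simp only [not_top_lt]
  | coe b =>
    rw [← EReal.coe_sub, ← EReal.coe_mul, EReal.coe_lt_coe_iff, EReal.coe_lt_coe_iff,
      ← sub_lt_iff_lt_add', lt_div_iff₀' hr]

/-- Dividing by `κ² v > 0` turns the event into `W / (κ v) ≤ s`, whatever the sign of `κ`, and `W /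
(κ v)` has variance `1 / (κ² v) = -q / κ²`. -/
lemma gaussianReal_real_le_eq_normalLaw {q κ : ℝ} (hq : q < 0) (hκ : κ ≠ 0) (s : ℝ) :
    (gaussianReal 0 (limitVar q)).real
        {w : ℝ | ((κ * w : ℝ) : EReal) ≤ ((s * κ ^ 2 * limitVar q : ℝ) : EReal)} =
      (normalLaw (-q / κ ^ 2) : Measure EReal).real (Set.Iic (s : EReal)) := by
  have hv : 0 < -1 / q := div_pos_of_neg_of_neg (by norm_num) hq
  have hvc : ((limitVar q : NNReal) : ℝ) = -1 / q := Real.coe_toNNReal _ hv.le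
  have hpre : Real.toEReal ⁻¹' Set.Iic (s : EReal) = Set.Iic s := by
    ext; simp
  have hvar : (-q / κ ^ 2).toNNReal =
      NNReal.mk ((1 / (κ * (-1 / q))) ^ 2) (sq_nonneg _) * limitVar q := by
    rw [← NNReal.coe_inj, Real.coe_toNNReal _ (div_nonneg (by linarith) (sq_nonneg _)),
      NNReal.coe_mul, hvc]
    change _ = (1 / (κ * (-1 / q))) ^ 2 * (-1 / q)
    have := hq.ne
    field_simp
  have hmap := gaussianReal_map_mul_const (μ := 0) (v := limitVar q) (1 / (κ * (-1 / q)))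
  rw [mul_zero, ← hvar] at hmap
  change _ = ((gaussianReal 0 (-q / κ ^ 2).toNNReal).map Real.toEReal).real _
  rw [map_measureReal_apply measurable_coe_real_ereal measurableSet_Iic, hpre, ← hmap,
    map_measureReal_apply (by fun_prop) measurableSet_Iic]
  congr 1
  ext w
  simp only [Set.mem_ofPred_eq, EReal.coe_le_coe_iff, Set.mem_preimage, Set.mem_Iic, hvc]
  have hpos : 0 < κ ^ 2 * (-1 / q) := by positivity
  have e : w * (1 / (κ * (-1 / q))) = κ * w / (κ ^ 2 * (-1 / q)) := by
    have := hq.ne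
    field_simp
  rw [e, div_le_iff₀ hpos, mul_assoc]

lemma convergesInLaw_normal {p : ℕ} (hp : 0 < p) {β h m q : ℝ}
    (hH : IsNondegenerateMax p β h m q) (hm0 : m ≠ 0) {betaHat : ∀ N : ℕ, Config N → EReal}
    (hmle : ∀ (N : ℕ) (X : Config N), IsMLE p N h X (betaHat N X)) :
    ConvergesInLaw p β h (fun N X => (√N : EReal) * (betaHat N X - (β : EReal)))
      (normalLaw (-q / (p * m ^ (p - 1)) ^ 2)) := by
  have hκ : (p * m ^ (p - 1) : ℝ) ≠ 0 := by
    have : (p : ℝ) ≠ 0 := by positivity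
    positivity
  have hr : ∀ᶠ N : ℕ in atTop, 0 < √(N : ℝ) := by
    filter_upwards [eventually_gt_atTop 0] with N hN
    positivity
  -- The estimate is compared with the moving point `β + s / √N`, at scale `√N` and with centring
  -- `m^p`. The limit has no atoms to avoid, so every real `s` is used.
  have key := fun s : ℝ => hH.tendsto_expect_threshold hp
    (γ := fun w => p * m ^ (p - 1) * w) (fun w x hx => tendsto_sqrt_mul_pow_sub hx) (by fun_prop)
    hr ((continuous_coe_real_ereal.tendsto _).comp (hH.tendsto_expect_response hp s)) (by
      have hfin : ({s * (p * m ^ (p - 1)) ^ 2 * limitVar q / (p * m ^ (p - 1))} : Set ℝ).Finite :=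
        Set.finite_singleton _
      filter_upwards [compl_mem_ae_iff.2 (hfin.measure_zero volume)] with w hw hcon
      rw [EReal.coe_eq_coe_iff] at hcon
      exact hw (by rw [Set.mem_singleton_iff, ← hcon, mul_div_cancel_left₀ _ hκ]))
  simp_rw [gaussianReal_real_le_eq_normalLaw hH.neg hκ] at key
  refine tendsto_probabilityMeasure_of_sandwich dense_univ (fun s _ => (key s).1)
    (fun s _ => (key s).2) ?_ ?_
  · intro s _
    filter_upwards [eventually_gt_atTop 0, hr] with N hN hrN
    exact expect_lt_le_law_real hp hN (hmle N) measurableSet_Iic fun X hX =>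
      (coe_mul_sub_le_iff hrN _ β s).2 hX
  · intro s _
    filter_upwards [eventually_gt_atTop 0, hr] with N hN hrN
    exact law_real_le_expect_le hp hN (hmle N) measurableSet_Iio fun X hX =>
      (coe_mul_sub_lt_iff hrN _ β s).1 hX

end CurieWeiss

theorem theorem2p5 (p : ℕ) (hp : 3 ≤ p) (β h : ℝ) (hreg : CurieWeiss.IsRegular p β h)
    (m : ℝ) (hm : CurieWeiss.IsUniqueMaximizer p β h m)
    (betaHat : ∀ N : ℕ, CurieWeiss.Config N → EReal)
    (hmle : ∀ (N : ℕ) (X : CurieWeiss.Config N), CurieWeiss.IsMLE p N h X (betaHat N X)) :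
    (m ≠ 0 →
      CurieWeiss.ConvergesInLaw p β h
        (fun N X => (Real.sqrt N : EReal) * (betaHat N X - (β : EReal)))
        (CurieWeiss.normalLaw
          (-iteratedDeriv 2 (CurieWeiss.H p β h) m / ((p : ℝ) ^ 2 * m ^ (2 * p - 2))))) ∧
    (m = 0 ↔ h = 0 ∧ β < CurieWeiss.betaTilde p) ∧
    (m = 0 →
      (Odd p →
        CurieWeiss.ConvergesInLaw p β h betaHat
          (CurieWeiss.twoPoint CurieWeiss.oneHalf
            ((CurieWeiss.betaTilde p : ℝ) : EReal) ((-CurieWeiss.betaTilde p : ℝ) : EReal))) ∧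
      (Even p →
        CurieWeiss.ConvergesInLaw p β h betaHat
          (CurieWeiss.twoPoint (CurieWeiss.gammaP p)
            ⊥ ((CurieWeiss.betaTilde p : ℝ) : EReal)))) := by
  have hp0 : 0 < p := by omega
  obtain ⟨hβ, m', hm', hq⟩ := hreg
  obtain rfl := hm.unique hm'
  refine ⟨fun hm0 => ?_, ⟨?_, ?_⟩, ?_⟩
  · have h1 := CurieWeiss.convergesInLaw_normal hp0 (hm.isNondegenerateMax hq) hm0 hmle
    rwa [mul_pow, ← pow_mul, show (p - 1) * 2 = 2 * p - 2 by omega] at h1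
  · rintro rfl
    obtain rfl := hm.field_eq_zero hp
    exact ⟨rfl, hm.lt_betaTilde hp hβ⟩
  · rintro ⟨rfl, hlt⟩
    exact hm.unique (CurieWeiss.isUniqueMaximizer_zero hp0.ne' hβ hlt)
  · rintro rfl
    obtain rfl := hm.field_eq_zero hp
    exact ⟨fun ho => CurieWeiss.convergesInLaw_of_odd hp ho hm hmle,
      fun he => CurieWeiss.convergesInLaw_of_even hp he hm hmle⟩
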